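/- Let $n\in\mathbb N$, $T>0$, $c\in\mathbb R^n$ with $c_i\ge 0$ (replenishment costs), and let $\sigma$ be a probability density on $[0,T]$ that is continuous and positive on $(0,T)$. Let $S=S(I,p)\in\mathbb R^n$ be a demand model, i.e. the vector of sales rates as a function of the inventory vector $I\in\mathbb R^n$ and the price vector $p\in\mathbb R^n$. Products, squares and quotients of vectors are taken componentwise, $1_n=(1,\dots,1)$, and $\langle\cdot,\cdot\rangle$ is the standard scalar product. Consider the problem $$\text{maximize}\quad \int_0^T\bigl[-\langle c,\rho^2\rangle+\langle p,S(I,p)\rangle\bigr]\,\sigma\,dt\qquad\text{subject to}\quad \frac{dI}{dt}=-S(I,p)\,\sigma+\rho^2\,\sigma,\quad I(0)=I_0,\ I(T)=I_T,$$ over all $(I,p,\rho)$ such that $I$ is continuous on $[0,T]$, $p,\rho$ are continuous on $(0,T)$, the flow equation holds on $(0,T)$, $I_i,\,p_i,\,S_i(I,p)>0$ and $\rho_i\ge 0$ on $(0,T)$ for all $i$, and the profit integrand is integrable on $[0,T]$. Let $(I,p,\rho)$ be an optimal trajectory, i.e. a maximizer of this problem. Suppose that $S$ is $C^1$ near every point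 $(I(t),p(t))$, $0<t<T$, and that the elasticity matrix $\Gamma=\bigl(S_i^{-1}\,\tfrac{\partial S_i}{\partial p_j}\,p_j\bigr)_{i,j}$ is invertible along the trajectory on $(0,T)$. Call $\lambda:(0,T)\to\mathbb R^n$ a Lagrange multiplier of the trajectory if the Euler–Lagrange equations $\partial L/\partial\rho=0$, $\partial L/\partial p=0$, $\frac{d}{dt}\,\partial L/\partial\dot I=\partial L/\partial I$ hold on $(0,T)$ for $$L=-\langle c,\rho^2\rangle\sigma+\langle p,S\rangle\sigma+\bigl\langle\lambda,\ \dot I+S\sigma-\rho^2\sigma\bigr\rangle .$$ Then a Lagrange multiplier exists, and for every Lagrange multiplier $\lambda$ the quantity $$\langle c+\lambda,\rho^2\rangle-\langle p+\lambda,S\rangle$$ is constant in time on $(0,T)$ and equals there $$-\langle p-c,\rho^2\rangle+\Bigl\langle R,\ \Gamma^{-1}\Bigl(1_n-\frac{\rho^2}{S}\Bigr)\Bigr\rangle,\qquad R=pS .$$ In particular, the latter quantity is constant in time on every such optimal trajectory. -/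

import Mathlib

noncomputable section

namespace RetailPricing

open MeasureTheory Set Matrix

/-! Vectors indexed by the `n` items are functions `Fin n → ℝ`; products, squares and quotients of
vectors are componentwise, and `⬝ᵥ` is the standard scalar product.  The demand model is a function
`S` of the inventory vector and the price vector, with values in the vectors of sales rates. -/

/-- The profit `∫₀ᵀ [ -⟨c, ρ²⟩ + ⟨p, S(I, p)⟩ ] σ dt`. -/
def profit {n : ℕ} (S : (Fin n → ℝ) → (Fin n → ℝ) → (Fin n → ℝ)) (σ : ℝ → ℝ) (T : ℝ)
    (c : Fin n → ℝ) (I p ρ : ℝ → Fin n → ℝ) : ℝ :=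
  ∫ t in (0 : ℝ)..T, (-(c ⬝ᵥ (ρ t) ^ 2) + p t ⬝ᵥ S (I t) (p t)) * σ t

/-- Admissible trajectories: continuous controls `p`, `ρ` and a continuous inventory `I` that obeys
the flow equation and the boundary conditions, has no stock-outs, and for which the profit integral
exists.  Regularity and positivity are only asked for at the inner times, so that, for example,
prices and inventories may tend to `0` at the terminal time. -/
structure IsAdmissible {n : ℕ} (S : (Fin n → ℝ) → (Fin n → ℝ) → (Fin n → ℝ)) (σ : ℝ → ℝ) (T : ℝ)
    (c I₀ I₁ : Fin n → ℝ) (I p ρ : ℝ → Fin n → ℝ) : Prop where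
  inventory_continuous : ContinuousOn I (Icc 0 T)
  price_continuous : ContinuousOn p (Ioo 0 T)
  replenishment_continuous : ContinuousOn ρ (Ioo 0 T)
  flow : ∀ t ∈ Ioo 0 T, HasDerivAt I (-(σ t • S (I t) (p t)) + σ t • (ρ t) ^ 2) t
  initial : I 0 = I₀
  terminal : I T = I₁
  inventory_pos : ∀ t ∈ Ioo 0 T, ∀ i, 0 < I t i
  price_pos : ∀ t ∈ Ioo 0 T, ∀ i, 0 < p t i
  sales_pos : ∀ t ∈ Ioo 0 T, ∀ i, 0 < S (I t) (p t) i
  replenishment_nonneg : ∀ t ∈ Ioo 0 T, ∀ i, 0 ≤ ρ t i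
  profit_integrable : IntervalIntegrable
    (fun t => (-(c ⬝ᵥ (ρ t) ^ 2) + p t ⬝ᵥ S (I t) (p t)) * σ t) volume 0 T

/-- Optimal trajectories: admissible ones of maximal profit. -/
def IsOptimal {n : ℕ} (S : (Fin n → ℝ) → (Fin n → ℝ) → (Fin n → ℝ)) (σ : ℝ → ℝ) (T : ℝ)
    (c I₀ I₁ : Fin n → ℝ) (I p ρ : ℝ → Fin n → ℝ) : Prop :=
  IsAdmissible S σ T c I₀ I₁ I p ρ ∧
    ∀ I' p' ρ' : ℝ → Fin n → ℝ, IsAdmissible S σ T c I₀ I₁ I' p' ρ' →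
      profit S σ T c I' p' ρ' ≤ profit S σ T c I p ρ

/-- The cross-elasticity matrix `Γᵢⱼ = Sᵢ⁻¹ (∂Sᵢ/∂pⱼ) pⱼ` at inventory `x` and price `q`. -/
def elasticity {n : ℕ} (S : (Fin n → ℝ) → (Fin n → ℝ) → (Fin n → ℝ)) (x q : Fin n → ℝ) :
    Matrix (Fin n) (Fin n) ℝ :=
  Matrix.of fun i j => (S x q i)⁻¹ * fderiv ℝ (S x) q (Pi.single j 1) i * q j

/-- The Lagrangian `-⟨c, r²⟩ s + ⟨q, S⟩ s + ⟨l, v + S s - r² s⟩`, `S = S(x, q)`, as a function of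
the seasonality `s`, inventory `x`, inventory velocity `v`, price `q`, replenishment `r` and
multiplier `l`. -/
def lagrangian {n : ℕ} (S : (Fin n → ℝ) → (Fin n → ℝ) → (Fin n → ℝ)) (c : Fin n → ℝ)
    (s : ℝ) (x v q r l : Fin n → ℝ) : ℝ :=
  -(c ⬝ᵥ r ^ 2) * s + (q ⬝ᵥ S x q) * s + l ⬝ᵥ (v + s • S x q - s • r ^ 2)

/-- `l` is a Lagrange multiplier function for the trajectory `(I, p, ρ)`: at all inner times the
Euler–Lagrange equations `∂L/∂ρ = 0`, `∂L/∂p = 0`, `d/dt (∂L/∂İ) = ∂L/∂I` hold. -/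
structure IsMultiplier {n : ℕ} (S : (Fin n → ℝ) → (Fin n → ℝ) → (Fin n → ℝ)) (σ : ℝ → ℝ) (T : ℝ)
    (c : Fin n → ℝ) (I p ρ l : ℝ → Fin n → ℝ) : Prop where
  replenishment_eq : ∀ t ∈ Ioo 0 T,
    HasFDerivAt (fun r => lagrangian S c (σ t) (I t) (deriv I t) (p t) r (l t))
      (0 : (Fin n → ℝ) →L[ℝ] ℝ) (ρ t)
  price_eq : ∀ t ∈ Ioo 0 T,
    HasFDerivAt (fun q => lagrangian S c (σ t) (I t) (deriv I t) q (ρ t) (l t))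
      (0 : (Fin n → ℝ) →L[ℝ] ℝ) (p t)
  inventory_eq : ∀ t ∈ Ioo 0 T,
    HasDerivAt
      (fun u => fderiv ℝ (fun v => lagrangian S c (σ u) (I u) v (p u) (ρ u) (l u)) (deriv I u))
      (fderiv ℝ (fun x => lagrangian S c (σ t) x (deriv I t) (p t) (ρ t) (l t)) (I t)) t

/-- The quantity `⟨c + λ, ρ²⟩ - ⟨p + λ, S⟩` at inventory `x`, price `q`, replenishment `r` and
multiplier `l`. -/
def hamiltonianQuantity {n : ℕ} (S : (Fin n → ℝ) → (Fin n → ℝ) → (Fin n → ℝ)) (c : Fin n → ℝ)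
    (x q r l : Fin n → ℝ) : ℝ :=
  (c + l) ⬝ᵥ r ^ 2 - (q + l) ⬝ᵥ S x q

/-- The quantity `-⟨p - c, ρ²⟩ + ⟨R, Γ⁻¹ (1ₙ - ρ² / S)⟩`, where `R = p S` is the revenue rate, at
inventory `x`, price `q` and replenishment `r`. -/
def salesInvariant {n : ℕ} (S : (Fin n → ℝ) → (Fin n → ℝ) → (Fin n → ℝ)) (c : Fin n → ℝ)
    (x q r : Fin n → ℝ) : ℝ :=
  -((q - c) ⬝ᵥ r ^ 2) + (q * S x q) ⬝ᵥ ((elasticity S x q)⁻¹ *ᵥ (1 - r ^ 2 / S x q))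

end RetailPricing

end

/-!
Take as controls the sales `Y = S(I, p)` and the squared replenishment `V = ρ²` instead of `p` and
`ρ`.  Invertibility of the elasticity matrix makes the price, locally in time, a continuously
differentiable function `G(I, Y)` (`exists_price_of_sales`), so an optimal trajectory locally
maximizes `∫ (-⟨c, V⟩ + f(I, Y)) σ`, `f(x, y) = ⟨G(x, y), y⟩`, under the linear flow equation
`I' = σ (V - Y)` (`IsOptimal.isReducedOptimal`).  Variations on small time intervals suffice, since
every assertion is local in time.

The price equation `∂L/∂p = 0` determines the multiplier pointwise, and by the chain rule it says
that `∂f/∂y = -λ`, `∂f/∂x = ⟨p + λ, ∂S/∂x⟩` along the trajectory (`PriceEquation.revenue_deriv`).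
The other conditions come from the first variation of the reduced problem
(`IsReducedOptimal.first_variation`), in three directions:

* a variation of `V` proportional to `V` itself, compensated by `Y`, gives `(c + λ) ρ = 0` in
  every component, that is `∂L/∂ρ = 0`;
* a variation of `I`, compensated by `Y`, gives the equation of `λ'`, by the lemma of
  du Bois-Reymond;
* a variation of the time scale gives the conservation law.  The controls are merely continuous,
  so the conservation law cannot be obtained by differentiating the Hamiltonian.  Under a change
  of the time scale, the trajectory is run through at a different speed and `Y` makes up for the
  speed.  After a change of variables in the profit integral no derivative of a control is
  involved.  The first variation is the integral of the Hamiltonian, up to sign, against `g'` for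
  an arbitrary test function `g`, so the Hamiltonian is constant.  The problem is autonomous in the
  seasonal clock `∫ σ`, and it is this clock that is varied.

Finally the price equation, in the direction `p Γ⁻¹ (1 - ρ² / S)`, turns the Hamiltonian into the
expression without multiplier (`PriceEquation.hamiltonianQuantity_eq`).
-/

namespace RetailPricing

open MeasureTheory Set Filter Topology Matrix

/-! ### Calculus on compact intervals -/

/-- Differentiation under the integral sign over a compact interval, for an integrand that is
continuous and continuously differentiable in the parameter near the slice `{x₀} × [α, β]`. -/
lemma hasDerivAt_intervalIntegral_of_eventually {q q' : ℝ → ℝ → ℝ} {α β x₀ : ℝ} (hαβ : α ≤ β)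
    (h : ∀ t ∈ Icc α β, ∀ᶠ z : ℝ × ℝ in 𝓝 (x₀, t),
      HasDerivAt (fun x => q x z.2) (q' z.1 z.2) z.1 ∧
        ContinuousAt (Function.uncurry q) z ∧ ContinuousAt (Function.uncurry q') z) :
    HasDerivAt (fun x => ∫ t in α..β, q x t) (∫ t in α..β, q' x₀ t) x₀ := by
  have hslice : ∀ {F : ℝ → ℝ → ℝ} {x t : ℝ}, ContinuousAt (Function.uncurry F) (x, t) →
      ContinuousAt (F x) t := fun {F x t} hF =>
    ContinuousAt.comp (f := fun s : ℝ => (x, s)) hF (by fun_prop)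
  have hq'0 : ContinuousOn (q' x₀) (Icc α β) := fun t ht =>
    (hslice (h t ht).self_of_nhds.2.2).continuousWithinAt
  obtain ⟨C, hC⟩ := isCompact_Icc.exists_bound_of_continuousOn hq'0
  have hev : ∀ᶠ x in 𝓝 x₀, ∀ t ∈ Icc α β, (HasDerivAt (fun x => q x t) (q' x t) x ∧
      ContinuousAt (Function.uncurry q) (x, t)) ∧ ‖q' x t‖ < C + 1 := by
    refine isCompact_Icc.eventually_forall_of_forall_eventually fun t ht => ?_
    have hlt : ∀ᶠ z : ℝ × ℝ in 𝓝 (x₀, t), ‖Function.uncurry q' z‖ < C + 1 :=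
      (h t ht).self_of_nhds.2.2.norm.eventually_lt_const
        (by simpa using (hC t ht).trans_lt (lt_add_one C))
    filter_upwards [h t ht, hlt] with z hz hz'
    exact ⟨⟨hz.1, hz.2.1⟩, hz'⟩
  have hΙ : ∀ {t}, t ∈ uIoc α β → t ∈ Icc α β := fun {t} ht => by
    rw [uIoc_of_le hαβ] at ht; exact Ioc_subset_Icc_self ht
  have hcont : ∀ x, (∀ t ∈ Icc α β, ContinuousAt (Function.uncurry q) (x, t)) →
      IntervalIntegrable (q x) volume α β := fun x hx => by
    refine ContinuousOn.intervalIntegrable fun t ht => ?_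
    rw [uIcc_of_le hαβ] at ht
    exact (hslice (hx t ht)).continuousWithinAt
  have hq'int : IntervalIntegrable (q' x₀) volume α β :=
    ContinuousOn.intervalIntegrable (by rwa [uIcc_of_le hαβ])
  refine (intervalIntegral.hasDerivAt_integral_of_dominated_loc_of_deriv_le
    (bound := fun _ => C + 1) hev ?_ (hcont x₀ fun t ht => (hev.self_of_nhds t ht).1.2) ?_
    (.of_forall fun t ht x hx => ((hx t (hΙ ht)).2).le) (by simp)
    (.of_forall fun t ht x hx => (hx t (hΙ ht)).1.1)).2
  · filter_upwards [hev] with x hx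
    exact (hcont x fun t ht => (hx t ht).1.2).def'.aestronglyMeasurable
  · exact hq'int.def'.aestronglyMeasurable

/-- A differentiable function on the line whose derivative is bounded below by a positive constant
is a bijection with differentiable inverse. -/
lemma exists_inverse_of_deriv_ge {F F' : ℝ → ℝ} {m : ℝ} (hm : 0 < m)
    (hF : ∀ t, HasDerivAt F (F' t) t) (hF' : ∀ t, m ≤ F' t) :
    ∃ θ : ℝ → ℝ, (∀ t, F (θ t) = t) ∧ (∀ t, θ (F t) = t) ∧
      ∀ t, HasDerivAt θ (F' (θ t))⁻¹ t := by
  have hmono : StrictMono F :=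
    strictMono_of_hasDerivAt_pos hF fun t => hm.trans_le (hF' t)
  have hcont : Continuous F := continuous_iff_continuousAt.2 fun t => (hF t).continuousAt
  have hmono' : Monotone fun t => F t - m * t := by
    refine monotone_of_hasDerivAt_nonneg (f' := fun t => F' t - m) (fun t => ?_) fun t => ?_
    · simpa using (hF t).fun_sub ((hasDerivAt_id t).const_mul m)
    · simpa using hF' t
  have htop : Tendsto F atTop atTop := by
    refine tendsto_atTop_mono' atTop ?_
      (tendsto_atTop_add_const_left atTop (F 0) (tendsto_id.const_mul_atTop hm))
    filter_upwards [eventually_ge_atTop 0] with t ht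
    have := hmono' ht
    simp only [mul_zero, sub_zero, id] at this ⊢
    linarith
  have hbot : Tendsto F atBot atBot := by
    refine tendsto_atBot_mono' atBot ?_
      (tendsto_atBot_add_const_left atBot (F 0) (tendsto_id.const_mul_atBot hm))
    filter_upwards [eventually_le_atBot 0] with t ht
    have := hmono' ht
    simp only [mul_zero, sub_zero, id] at this ⊢
    linarith
  let e := StrictMono.orderIsoOfSurjective F hmono (hcont.surjective htop hbot)
  have h1 : ∀ t, F (e.symm t) = t := fun t => e.apply_symm_apply t
  refine ⟨e.symm, h1, fun t => e.symm_apply_apply t, fun t => ?_⟩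
  exact (hF (e.symm t)).of_local_left_inverse e.symm.continuous.continuousAt
    (hm.trans_le (hF' _)).ne' (.of_forall h1)

/-! ### Test functions -/

/-- `g` is a continuously differentiable function on the line, with derivative `g'`, that vanishes
off the open interval `(α, β)` together with its derivative. -/
structure IsTestPair {F : Type*} [NormedAddCommGroup F] [NormedSpace ℝ F] (α β : ℝ)
    (g g' : ℝ → F) : Prop where
  hasDerivAt : ∀ t, HasDerivAt g (g' t) t
  continuous_deriv : Continuous g'
  eq_zero : ∀ t, t ∉ Ioo α β → g t = 0
  deriv_eq_zero : ∀ t, t ∉ Ioo α β → g' t = 0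

namespace IsTestPair

variable {F : Type*} [NormedAddCommGroup F] [NormedSpace ℝ F] {α β : ℝ} {g g' : ℝ → F}

lemma continuous (h : IsTestPair α β g g') : Continuous g :=
  continuous_iff_continuousAt.2 fun t => (h.hasDerivAt t).continuousAt

lemma clm_comp {H : Type*} [NormedAddCommGroup H] [NormedSpace ℝ H] (h : IsTestPair α β g g')
    (A : F →L[ℝ] H) : IsTestPair α β (fun t => A (g t)) (fun t => A (g' t)) where
  hasDerivAt t := A.hasFDerivAt.comp_hasDerivAt t (h.hasDerivAt t)
  continuous_deriv := A.continuous.comp h.continuous_deriv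
  eq_zero t ht := by simp [h.eq_zero t ht]
  deriv_eq_zero t ht := by simp [h.deriv_eq_zero t ht]

end IsTestPair

lemma isTestPair_zero {F : Type*} [NormedAddCommGroup F] [NormedSpace ℝ F] (α β : ℝ) :
    IsTestPair α β (fun _ => (0 : F)) (fun _ => 0) where
  hasDerivAt t := hasDerivAt_const t 0
  continuous_deriv := continuous_const
  eq_zero _ _ := rfl
  deriv_eq_zero _ _ := rfl

/-- A continuous cutoff function, positive exactly on `(α, β)`. -/
def cutoff (α β t : ℝ) : ℝ := max 0 ((t - α) * (β - t))

lemma continuous_cutoff (α β : ℝ) : Continuous (cutoff α β) := by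
  unfold cutoff; fun_prop

lemma cutoff_nonneg (α β t : ℝ) : 0 ≤ cutoff α β t := le_max_left _ _

lemma cutoff_pos {α β t : ℝ} (ht : t ∈ Ioo α β) : 0 < cutoff α β t :=
  lt_max_of_lt_right (mul_pos (sub_pos.2 ht.1) (sub_pos.2 ht.2))

lemma cutoff_eq_zero {α β t : ℝ} (hαβ : α ≤ β) (ht : t ∉ Ioo α β) : cutoff α β t = 0 := by
  refine max_eq_left ?_
  rw [mem_Ioo, not_and_or, not_lt, not_lt] at ht
  rcases ht with ht | ht <;> nlinarith

lemma eqOn_zero_of_integral_cutoff_mul_sq {α β : ℝ} (hαβ : α < β) {h : ℝ → ℝ}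
    (hh : ContinuousOn h (Icc α β)) (h0 : ∫ t in α..β, cutoff α β t * h t ^ 2 = 0) :
    ∀ t ∈ Ioo α β, h t = 0 := by
  intro t ht
  by_contra hne
  refine h0.not_gt (intervalIntegral.integral_pos hαβ
    ((continuous_cutoff α β).continuousOn.mul (hh.pow 2))
    (fun s _ => mul_nonneg (cutoff_nonneg _ _ _) (sq_nonneg _))
    ⟨t, Ioo_subset_Icc_self ht, mul_pos (cutoff_pos ht) (by positivity)⟩)

/-- The lemma of du Bois-Reymond. -/
lemma exists_eq_const_of_integral_mul_deriv_eq_zero {α β : ℝ} (hαβ : α < β) {h : ℝ → ℝ}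
    (hh : ContinuousOn h (Icc α β))
    (H : ∀ g g' : ℝ → ℝ, IsTestPair α β g g' → ∫ t in α..β, h t * g' t = 0) :
    ∃ k, ∀ t ∈ Ioo α β, h t = k := by
  have hφ := continuous_cutoff α β
  have hφh : ContinuousOn (fun t => cutoff α β t * h t) (uIcc α β) := by
    rw [uIcc_of_le hαβ.le]; exact hφ.continuousOn.mul hh
  have hφpos : 0 < ∫ t in α..β, cutoff α β t :=
    intervalIntegral.integral_pos hαβ hφ.continuousOn (fun s _ => cutoff_nonneg _ _ _)
      ⟨(α + β) / 2, ⟨by linarith, by linarith⟩, cutoff_pos ⟨by linarith, by linarith⟩⟩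
  -- the mean of `h` with weight `cutoff α β`, so that `cutoff α β * (h - k)` is a derivative
  set k := (∫ t in α..β, cutoff α β t * h t) / ∫ t in α..β, cutoff α β t with hk
  refine ⟨k, ?_⟩
  set hx : ℝ → ℝ := IccExtend hαβ.le ((Icc α β).domRestrict h) with hhx
  have hxc : Continuous hx := (continuousOn_iff_continuous_domRestrict.1 hh).Icc_extend'
  have hxe : ∀ t ∈ Icc α β, hx t = h t := fun t ht => by
    rw [hhx, IccExtend_of_mem _ _ ht, domRestrict_apply]
  set d : ℝ → ℝ := fun t => cutoff α β t * (hx t - k) with hd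
  have hdc : Continuous d := hφ.mul (hxc.sub continuous_const)
  have hd0 : ∀ t, t ∉ Ioo α β → d t = 0 := fun t ht => by
    simp [hd, cutoff_eq_zero hαβ.le ht]
  have hdint : ∫ t in α..β, d t = 0 := by
    have : ∫ t in α..β, d t = ∫ t in α..β, (cutoff α β t * h t - cutoff α β t * k) := by
      refine intervalIntegral.integral_congr fun t ht => ?_
      rw [uIcc_of_le hαβ.le] at ht
      simp only [hd, hxe t ht]; ring
    have hφk : IntervalIntegrable (fun t => cutoff α β t * k) volume α β :=
      (hφ.mul continuous_const).intervalIntegrable _ _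
    rw [this, intervalIntegral.integral_sub hφh.intervalIntegrable hφk,
      intervalIntegral.integral_mul_const, hk]
    field_simp
    ring
  have htest : IsTestPair α β (fun t => ∫ s in α..t, d s) d := by
    refine ⟨fun t => hdc.integral_hasStrictDerivAt α t |>.hasDerivAt, hdc, fun t ht => ?_, hd0⟩
    rw [mem_Ioo, not_and_or, not_lt, not_lt] at ht
    rcases ht with ht | ht
    · refine (intervalIntegral.integral_congr (g := fun _ => (0 : ℝ)) fun s hs => ?_).trans
        intervalIntegral.integral_zero
      rw [uIcc_of_ge ht] at hs
      exact hd0 s fun hs' => hs'.1.not_ge hs.2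
    · rw [← intervalIntegral.integral_add_adjacent_intervals (b := β)
        (hdc.intervalIntegrable _ _) (hdc.intervalIntegrable _ _), hdint, zero_add]
      refine (intervalIntegral.integral_congr (g := fun _ => (0 : ℝ)) fun s hs => ?_).trans
        intervalIntegral.integral_zero
      rw [uIcc_of_le ht] at hs
      exact hd0 s fun hs' => hs'.2.not_ge hs.1
  have hsq : ∫ t in α..β, cutoff α β t * (h t - k) ^ 2 = 0 := by
    have h1 : ∫ t in α..β, cutoff α β t * (h t - k) ^ 2 = ∫ t in α..β, (h t * d t - k * d t) := by
      refine intervalIntegral.integral_congr fun t ht => ?_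
      rw [uIcc_of_le hαβ.le] at ht
      simp only [hd, hxe t ht]; ring
    rw [h1, intervalIntegral.integral_sub, H _ _ htest, intervalIntegral.integral_const_mul, hdint,
      mul_zero, sub_zero]
    · refine ContinuousOn.intervalIntegrable ?_
      rw [uIcc_of_le hαβ.le]; exact hh.mul hdc.continuousOn
    · exact (continuous_const.mul hdc).intervalIntegrable _ _
  intro t ht
  exact sub_eq_zero.1
    (eqOn_zero_of_integral_cutoff_mul_sq hαβ (hh.sub continuousOn_const) hsq t ht)

/-- The Euler–Lagrange equation in its integrated form: if `∫ (A g + B g') = 0` for all test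
functions `g`, then `B' = A`. -/
lemma hasDerivAt_of_integral_add_eq_zero {α β : ℝ} (hαβ : α < β) {A B : ℝ → ℝ}
    (hA : ContinuousOn A (Icc α β)) (hB : ContinuousOn B (Icc α β))
    (H : ∀ g g' : ℝ → ℝ, IsTestPair α β g g' → ∫ t in α..β, (A t * g t + B t * g' t) = 0) :
    ∀ t ∈ Ioo α β, HasDerivAt B (A t) t := by
  set a : ℝ → ℝ := IccExtend hαβ.le ((Icc α β).domRestrict A) with ha
  have hac : Continuous a := (continuousOn_iff_continuous_domRestrict.1 hA).Icc_extend'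
  have hae : ∀ t ∈ Icc α β, a t = A t := fun t ht => by
    rw [ha, IccExtend_of_mem _ _ ht, domRestrict_apply]
  set P : ℝ → ℝ := fun t => ∫ s in α..t, a s with hP
  have hPd : ∀ t, HasDerivAt P (a t) t := fun t =>
    (hac.integral_hasStrictDerivAt α t).hasDerivAt
  have hPc : Continuous P := continuous_iff_continuousAt.2 fun t => (hPd t).continuousAt
  obtain ⟨k, hk⟩ := exists_eq_const_of_integral_mul_deriv_eq_zero hαβ
    (hB.sub hPc.continuousOn) fun g g' hg => by
      have hparts : ∫ t in α..β, (a t * g t + P t * g' t) = 0 := by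
        rw [intervalIntegral.integral_deriv_mul_eq_sub (fun t _ => hPd t)
          (fun t _ => hg.hasDerivAt t) (hac.intervalIntegrable _ _)
          (hg.continuous_deriv.intervalIntegrable _ _), hg.eq_zero α (by simp),
          hg.eq_zero β (by simp)]
        simp
      refine Eq.trans ?_ ((congrArg₂ (· - ·) (H g g' hg) hparts).trans (sub_self 0))
      rw [← intervalIntegral.integral_sub]
      · refine intervalIntegral.integral_congr fun t ht => ?_
        rw [uIcc_of_le hαβ.le] at ht
        simp only [Pi.sub_apply, hae t ht]
        ring
      · refine ContinuousOn.intervalIntegrable ?_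
        rw [uIcc_of_le hαβ.le]
        exact (hA.mul hg.continuous.continuousOn).add (hB.mul hg.continuous_deriv.continuousOn)
      · exact ((hac.mul hg.continuous).add (hPc.mul hg.continuous_deriv)).intervalIntegrable _ _
  intro t ht
  rw [← hae t (Ioo_subset_Icc_self ht)]
  refine ((hPd t).add_const k).congr_of_eventuallyEq ?_
  filter_upwards [isOpen_Ioo.mem_nhds ht] with s hs
  have := hk s hs
  simp only [Pi.sub_apply] at this
  linarith

/-- A change of the time scale that is prescribed in the seasonal clock `∫ σ`: the new time `θ` is
the one at which the seasonal clock, shifted by the test function `g`, shows the old time. -/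
lemma exists_time_change {a b α β : ℝ} (hα : a < α) (hαβ : α < β) (hβ : β < b) {σ g g' : ℝ → ℝ}
    (hσ : ContinuousOn σ (Ioo a b)) (hσ0 : ∀ t ∈ Ioo a b, 0 < σ t) (hg : IsTestPair α β g g')
    (hpos : ∀ t ∈ Icc α β, 0 < σ t + g' t) :
    ∃ θ : ℝ → ℝ, (∀ t, t ∉ Ioo α β → θ t = t) ∧ (∀ t ∈ Icc α β, θ t ∈ Icc α β) ∧
      ∀ t ∈ Ioo a b, HasDerivAt θ (σ t / (σ (θ t) + g' (θ t))) t := by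
  have hsub : Icc α β ⊆ Ioo a b := fun t ht => ⟨hα.trans_le ht.1, ht.2.trans_lt hβ⟩
  set s : ℝ → ℝ := IccExtend hαβ.le ((Icc α β).domRestrict σ) with hs
  have hsc : Continuous s :=
    (continuousOn_iff_continuous_domRestrict.1 (hσ.mono hsub)).Icc_extend'
  have hse : ∀ t ∈ Icc α β, s t = σ t := fun t ht => by
    rw [hs, IccExtend_of_mem _ _ ht, domRestrict_apply]
  have hproj : ∀ t, ∃ u ∈ Icc α β, s t = σ u ∧ g' t = g' u := by
    intro t
    refine ⟨projIcc α β hαβ.le t, (projIcc α β hαβ.le t).2, rfl, ?_⟩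
    rcases le_total t α with h | h
    · rw [projIcc_of_le_left _ h, hg.deriv_eq_zero t (by simp [h.not_gt]),
        hg.deriv_eq_zero α (by simp)]
    rcases le_total β t with h' | h'
    · rw [projIcc_of_right_le _ h', hg.deriv_eq_zero t (by simp [h'.not_gt]),
        hg.deriv_eq_zero β (by simp)]
    · rw [projIcc_of_mem _ ⟨h, h'⟩]
  obtain ⟨u₁, hu₁, hmin₁⟩ := isCompact_Icc.exists_isMinOn (nonempty_Icc.2 hαβ.le)
    ((hσ.mono hsub).add hg.continuous_deriv.continuousOn)
  obtain ⟨u₂, hu₂, hmin₂⟩ := isCompact_Icc.exists_isMinOn (nonempty_Icc.2 hαβ.le) (hσ.mono hsub)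
  set P : ℝ → ℝ := fun t => ∫ r in α..t, s r with hP
  have hPd : ∀ t, HasDerivAt P (s t) t := fun t =>
    (hsc.integral_hasStrictDerivAt α t).hasDerivAt
  obtain ⟨φ, hφ1, hφ2, hφd⟩ := exists_inverse_of_deriv_ge (F := fun t => P t + g t)
    (hpos u₁ hu₁) (fun t => (hPd t).add (hg.hasDerivAt t)) fun t => by
      obtain ⟨u, hu, h1, h2⟩ := hproj t
      rw [h1, h2]; exact hmin₁ hu
  have hout : ∀ t, t ∉ Ioo α β → φ (P t) = t := fun t ht => by
    simpa [hg.eq_zero t ht] using hφ2 t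
  have hPinj : Function.Injective P := by
    obtain ⟨χ, -, hχ, -⟩ := exists_inverse_of_deriv_ge (F := P)
      (hσ0 u₂ (hsub hu₂)) hPd fun t => by
        obtain ⟨u, hu, h1, h2⟩ := hproj t
        rw [h1]; exact hmin₂ hu
    exact Function.LeftInverse.injective hχ
  have hmaps : ∀ t ∈ Icc α β, φ (P t) ∈ Icc α β := by
    intro t ht
    by_contra hn
    have h1 : P (φ (P t)) = P t := by
      simpa [hg.eq_zero _ fun h => hn (Ioo_subset_Icc_self h)] using hφ1 (P t)
    exact hn ((hPinj h1).symm ▸ ht)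
  refine ⟨fun t => φ (P t), hout, hmaps, fun t ht => ?_⟩
  by_cases htI : t ∈ Icc α β
  · have := (hφd (P t)).comp t (hPd t)
    rw [hse t htI, hse _ (hmaps t htI), ← div_eq_inv_mul] at this
    exact this
  · have ht' : t ∉ Ioo α β := fun h => htI (Ioo_subset_Icc_self h)
    simp only
    rw [hout t ht', hg.deriv_eq_zero t ht', add_zero, div_self (hσ0 t ht).ne']
    refine (hasDerivAt_id t).congr_of_eventuallyEq ?_
    filter_upwards [isClosed_Icc.isOpen_compl.mem_nhds htI] with r hr
    exact hout r fun h => hr (Ioo_subset_Icc_self h)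

/-! ### First variation of the reduced problem -/

/-- Trajectories of the reduced problem, in which the sales `Y` and the squared replenishment `V`
are the controls: the inventory `X` obeys `X' = σ (V - Y)` on `(a, b)`, and the pair `(X, Y)` stays
in the region `W` on which sales can be traded for prices. -/
structure IsFlow {n : ℕ} (σ : ℝ → ℝ) (a b : ℝ) (W : Set ((Fin n → ℝ) × (Fin n → ℝ)))
    (X Y V : ℝ → Fin n → ℝ) : Prop where
  hasDerivAt : ∀ t ∈ Ioo a b, HasDerivAt X (σ t • (V t - Y t)) t
  sales_continuous : ContinuousOn Y (Ioo a b)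
  inflow_continuous : ContinuousOn V (Ioo a b)
  mem : ∀ t ∈ Ioo a b, (X t, Y t) ∈ W
  inflow_nonneg : ∀ t ∈ Ioo a b, 0 ≤ V t

/-- Trajectories of the reduced problem, with cost functional `κ` and revenue `f`, that cannot be
improved by a change on a compact subinterval of `(a, b)`. -/
structure IsReducedOptimal {n : ℕ} (κ : (Fin n → ℝ) →L[ℝ] ℝ)
    (f : (Fin n → ℝ) × (Fin n → ℝ) → ℝ) (σ : ℝ → ℝ) (a b : ℝ)
    (W : Set ((Fin n → ℝ) × (Fin n → ℝ))) (X Y V : ℝ → Fin n → ℝ) : Prop where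
  flow : IsFlow σ a b W X Y V
  le : ∀ (α β : ℝ) (X₁ Y₁ V₁ : ℝ → Fin n → ℝ), a < α → α < β → β < b → IsFlow σ a b W X₁ Y₁ V₁ →
    (∀ t ∈ Ioo a b, t ∉ Ioo α β → X₁ t = X t ∧ Y₁ t = Y t ∧ V₁ t = V t) →
    ∫ t in α..β, (-κ (V₁ t) + f (X₁ t, Y₁ t)) * σ t ≤ ∫ t in α..β, (-κ (V t) + f (X t, Y t)) * σ t

/-- The first variation under a simultaneous change of the inventory by `ε δ`, of the squared
replenishment by `ε U`, and of the seasonal clock by `ε g`.  The sales are adjusted so that the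
flow equation holds.  The clock change does not ask for a derivative of the controls, which are
merely continuous. -/
lemma IsReducedOptimal.first_variation {n : ℕ} {κ : (Fin n → ℝ) →L[ℝ] ℝ}
    {f : (Fin n → ℝ) × (Fin n → ℝ) → ℝ}
    {f' : (Fin n → ℝ) × (Fin n → ℝ) → (Fin n → ℝ) × (Fin n → ℝ) →L[ℝ] ℝ} {σ : ℝ → ℝ} {a b α β : ℝ}
    {W : Set ((Fin n → ℝ) × (Fin n → ℝ))} {X Y V : ℝ → Fin n → ℝ}
    (hopt : IsReducedOptimal κ f σ a b W X Y V) (hW : IsOpen W)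
    (hf : ∀ z ∈ W, HasFDerivAt f (f' z) z) (hf' : ContinuousOn f' W)
    (hσ : ContinuousOn σ (Ioo a b)) (hσ0 : ∀ t ∈ Ioo a b, 0 < σ t)
    (hα : a < α) (hαβ : α < β) (hβ : β < b)
    {δ δ' U : ℝ → Fin n → ℝ} {g g' : ℝ → ℝ} (hδ : IsTestPair α β δ δ') (hg : IsTestPair α β g g')
    (hUc : ContinuousOn U (Ioo a b)) (hU0 : ∀ t, t ∉ Ioo α β → U t = 0)
    (hU : ∀ᶠ ε : ℝ in 𝓝 0, ∀ t ∈ Icc α β, 0 ≤ V t + ε • U t) :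
    ∫ t in α..β, ((-κ (U t) + f' (X t, Y t)
      (δ t, U t - (σ t)⁻¹ • δ' t + (g' t / σ t) • (V t - Y t))) * σ t +
        (-κ (V t) + f (X t, Y t)) * g' t) = 0 := by
  obtain ⟨⟨hXd, hYc, hVc, hmem, hV0⟩, hle⟩ := hopt
  have hsub : Icc α β ⊆ Ioo a b := fun t ht => ⟨hα.trans_le ht.1, ht.2.trans_lt hβ⟩
  set s : ℝ → ℝ → ℝ := fun ε t => σ t + ε * g' t with hs
  set XX : ℝ → ℝ → Fin n → ℝ := fun ε t => X t + ε • δ t with hXX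
  set VV : ℝ → ℝ → Fin n → ℝ := fun ε t => V t + ε • U t with hVV
  set J : ℝ → ℝ → Fin n → ℝ := fun ε t => σ t • (V t - Y t) + ε • δ' t with hJ
  set YY : ℝ → ℝ → Fin n → ℝ := fun ε t => VV ε t - (s ε t)⁻¹ • J ε t with hYY
  set YY' : ℝ → ℝ → Fin n → ℝ := fun ε t =>
    U t - ((s ε t)⁻¹ • δ' t + (-g' t / s ε t ^ 2) • J ε t) with hYY'
  set q : ℝ → ℝ → ℝ := fun ε t => (-κ (VV ε t) + f (XX ε t, YY ε t)) * s ε t with hq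
  set q' : ℝ → ℝ → ℝ := fun ε t => (-κ (U t) + f' (XX ε t, YY ε t) (δ t, YY' ε t)) * s ε t +
    (-κ (VV ε t) + f (XX ε t, YY ε t)) * g' t with hq'
  have hYY0 : ∀ t ∈ Ioo a b, YY 0 t = Y t := fun t ht => by
    simp [hYY, hVV, hs, hJ, smul_smul, inv_mul_cancel₀ (hσ0 t ht).ne']
  -- continuity of the ingredients in the parameter and the time
  have cX : ∀ {z : ℝ × ℝ}, z.2 ∈ Ioo a b → ContinuousAt (fun z : ℝ × ℝ => X z.2) z :=
    fun {z} hz => ContinuousAt.comp (f := Prod.snd) (hXd _ hz).continuousAt continuousAt_snd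
  have con : ∀ {H : Type} [TopologicalSpace H] {F : ℝ → H}, ContinuousOn F (Ioo a b) →
      ∀ {z : ℝ × ℝ}, z.2 ∈ Ioo a b → ContinuousAt (fun z : ℝ × ℝ => F z.2) z :=
    fun {H _ F} hF {z} hz => ContinuousAt.comp (f := Prod.snd)
      (hF.continuousAt (isOpen_Ioo.mem_nhds hz)) continuousAt_snd
  have cδ : Continuous δ := hδ.continuous
  have cδ' : Continuous δ' := hδ.continuous_deriv
  have cg' : Continuous g' := hg.continuous_deriv
  have cs : ∀ {z : ℝ × ℝ}, z.2 ∈ Ioo a b → ContinuousAt (fun z : ℝ × ℝ => s z.1 z.2) z :=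
    fun {z} hz => (con hσ hz).add (continuousAt_fst.mul (cg'.comp continuous_snd).continuousAt)
  have cXX : ∀ {z : ℝ × ℝ}, z.2 ∈ Ioo a b → ContinuousAt (fun z : ℝ × ℝ => XX z.1 z.2) z :=
    fun {z} hz => (cX hz).add (continuousAt_fst.smul (cδ.comp continuous_snd).continuousAt)
  have cVV : ∀ {z : ℝ × ℝ}, z.2 ∈ Ioo a b → ContinuousAt (fun z : ℝ × ℝ => VV z.1 z.2) z :=
    fun {z} hz => (con hVc hz).add (continuousAt_fst.smul (con hUc hz))
  have cJ : ∀ {z : ℝ × ℝ}, z.2 ∈ Ioo a b → ContinuousAt (fun z : ℝ × ℝ => J z.1 z.2) z :=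
    fun {z} hz => ((con hσ hz).smul ((con hVc hz).sub (con hYc hz))).add
      (continuousAt_fst.smul (cδ'.comp continuous_snd).continuousAt)
  have cYY : ∀ {z : ℝ × ℝ}, z.2 ∈ Ioo a b → s z.1 z.2 ≠ 0 →
      ContinuousAt (fun z : ℝ × ℝ => YY z.1 z.2) z := fun {z} hz hz' =>
    (cVV hz).sub (((cs hz).inv₀ hz').smul (cJ hz))
  have cYY' : ∀ {z : ℝ × ℝ}, z.2 ∈ Ioo a b → s z.1 z.2 ≠ 0 →
      ContinuousAt (fun z : ℝ × ℝ => YY' z.1 z.2) z := fun {z} hz hz' => by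
    refine (con hUc hz).sub ((((cs hz).inv₀ hz').smul (by fun_prop)).add
      (ContinuousAt.smul (ContinuousAt.div (by fun_prop) ((cs hz).pow 2) (pow_ne_zero 2 hz')) (cJ hz)))
  -- for small parameters the varied data are legitimate
  have hgood : ∀ t ∈ Icc α β, ∀ᶠ z : ℝ × ℝ in 𝓝 (0, t),
      z.2 ∈ Ioo a b ∧ 0 < s z.1 z.2 ∧ (XX z.1 z.2, YY z.1 z.2) ∈ W := fun t ht => by
    have hs0 : 0 < s 0 t := by simpa [hs] using hσ0 t (hsub ht)
    refine (continuousAt_snd.eventually_mem (isOpen_Ioo.mem_nhds (hsub ht))).and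
      (((cs (z := (0, t)) (hsub ht)).eventually_const_lt hs0).and ?_)
    refine ((cXX (z := (0, t)) (hsub ht)).prodMk (cYY (hsub ht) hs0.ne')).eventually_mem
      (hW.mem_nhds ?_)
    simpa [hYY0 t (hsub ht), hXX] using hmem t (hsub ht)
  have hderiv : HasDerivAt (fun ε => ∫ t in α..β, q ε t) (∫ t in α..β, q' 0 t) 0 := by
    refine hasDerivAt_intervalIntegral_of_eventually hαβ.le fun t ht => ?_
    filter_upwards [hgood t ht] with z ⟨hz, hz1, hz2⟩
    have cz := (cXX hz).prodMk (cYY hz hz1.ne')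
    have cf : ContinuousAt (fun z : ℝ × ℝ => f (XX z.1 z.2, YY z.1 z.2)) z :=
      ContinuousAt.comp (f := fun z : ℝ × ℝ => (XX z.1 z.2, YY z.1 z.2)) (hf _ hz2).continuousAt cz
    have cf' : ContinuousAt (fun z : ℝ × ℝ => f' (XX z.1 z.2, YY z.1 z.2)) z :=
      ContinuousAt.comp (f := fun z : ℝ × ℝ => (XX z.1 z.2, YY z.1 z.2))
        (hf'.continuousAt (hW.mem_nhds hz2)) cz
    have cκV : ContinuousAt (fun z : ℝ × ℝ => κ (VV z.1 z.2)) z :=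
      κ.continuous.continuousAt.comp (cVV hz)
    have cκU : ContinuousAt (fun z : ℝ × ℝ => κ (U z.2)) z :=
      κ.continuous.continuousAt.comp (con hUc hz)
    refine ⟨?_, ((cκV.neg.add cf).mul (cs hz)), ((cκU.neg.add (cf'.clm_apply
      (ContinuousAt.prodMk (by fun_prop) (cYY' hz hz1.ne')))).mul (cs hz)).add
        ((cκV.neg.add cf).mul (by fun_prop))⟩
    have dlin : ∀ {H : Type} [NormedAddCommGroup H] [NormedSpace ℝ H] (u v : H),
        HasDerivAt (fun ε : ℝ => u + ε • v) v z.1 := fun u v => by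
      simpa using ((hasDerivAt_id z.1).smul_const v).const_add u
    have ds : HasDerivAt (fun ε => s ε z.2) (g' z.2) z.1 := dlin (σ z.2) (g' z.2)
    have dY : HasDerivAt (fun ε => YY ε z.2) (YY' z.1 z.2) z.1 :=
      (dlin _ _).fun_sub ((ds.fun_inv hz1.ne').fun_smul (dlin _ _))
    have df : HasDerivAt (fun ε => f (XX ε z.2, YY ε z.2))
        (f' (XX z.1 z.2, YY z.1 z.2) (δ z.2, YY' z.1 z.2)) z.1 :=
      (hf _ hz2).comp_hasDerivAt z.1 ((dlin (X z.2) (δ z.2)).prodMk dY)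
    exact ((κ.hasFDerivAt.comp_hasDerivAt z.1 (dlin (V z.2) (U z.2))).fun_neg.fun_add df).fun_mul ds
  have hmax : IsLocalMax (fun ε => ∫ t in α..β, q ε t) 0 := by
    have hev : ∀ᶠ ε in 𝓝 (0 : ℝ), ∀ t ∈ Icc α β, 0 < s ε t ∧ (XX ε t, YY ε t) ∈ W :=
      isCompact_Icc.eventually_forall_of_forall_eventually fun t ht =>
        (hgood t ht).mono fun z hz => hz.2
    filter_upwards [hev, hU] with ε hε hεU
    have hεg : IsTestPair α β (fun t => ε * g t) (fun t => ε * g' t) :=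
      hg.clm_comp (ε • ContinuousLinearMap.id ℝ ℝ)
    obtain ⟨θ, hθ1, hθ2, hθd⟩ := exists_time_change hα hαβ hβ hσ hσ0 hεg fun t ht => (hε t ht).1
    have hθab : ∀ t ∈ Ioo a b, θ t ∈ Ioo a b := fun t ht => by
      by_cases htI : t ∈ Ioo α β
      · exact hsub (hθ2 t (Ioo_subset_Icc_self htI))
      · rwa [hθ1 t htI]
    have hθc : ContinuousOn θ (Ioo a b) := fun t ht => (hθd t ht).continuousAt.continuousWithinAt
    have hoff : ∀ t ∈ Ioo a b, t ∉ Ioo α β → s ε t = σ t ∧ XX ε t = X t ∧ YY ε t = Y t ∧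
        VV ε t = V t := fun t ht htI => by
      simp [hs, hXX, hYY, hVV, hJ, hg.deriv_eq_zero t htI, hδ.eq_zero t htI,
        hδ.deriv_eq_zero t htI, hU0 t htI, smul_smul, inv_mul_cancel₀ (hσ0 t ht).ne']
    have hs0 : ∀ t ∈ Ioo a b, 0 < s ε t := fun t ht => by
      by_cases htI : t ∈ Ioo α β
      · exact (hε t (Ioo_subset_Icc_self htI)).1
      · rw [(hoff t ht htI).1]; exact hσ0 t ht
    have slice : ∀ {H : Type} [TopologicalSpace H] {F : ℝ → ℝ → H},
        (∀ t ∈ Ioo a b, ContinuousAt (fun z : ℝ × ℝ => F z.1 z.2) (ε, t)) →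
        ContinuousOn (F ε) (Ioo a b) := fun {H _ F} hF t ht =>
      (ContinuousAt.comp (f := fun t : ℝ => (ε, t)) (hF t ht)
        (by fun_prop)).continuousWithinAt
    have cVε : ContinuousOn (VV ε) (Ioo a b) := slice fun t ht => cVV ht
    have cYε : ContinuousOn (YY ε) (Ioo a b) := slice fun t ht => cYY ht (hs0 t ht).ne'
    have hflow : IsFlow σ a b W (fun t => XX ε (θ t)) (fun t => YY ε (θ t))
        (fun t => VV ε (θ t)) := by
      refine ⟨fun t ht => ?_, cYε.comp hθc hθab, cVε.comp hθc hθab, fun t ht => ?_,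
        fun t ht => ?_⟩
      · have hX : HasDerivAt (XX ε) (J ε (θ t)) (θ t) :=
          (hXd _ (hθab t ht)).fun_add ((hδ.hasDerivAt (θ t)).fun_const_smul ε)
        refine (hX.scomp t (hθd t ht)).congr_deriv ?_
        simp only [hYY, sub_sub_cancel, smul_smul, div_eq_mul_inv, hs]
      · by_cases htI : t ∈ Ioo α β
        · exact (hε _ (hθ2 t (Ioo_subset_Icc_self htI))).2
        · rw [hθ1 t htI, (hoff t ht htI).2.1, (hoff t ht htI).2.2.1]; exact hmem t ht
      · by_cases htI : t ∈ Ioo α β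
        · exact hεU _ (hθ2 t (Ioo_subset_Icc_self htI))
        · rw [hθ1 t htI, (hoff t ht htI).2.2.2]; exact hV0 t ht
    have hcomp := hle α β _ _ _ hα hαβ hβ hflow fun t ht htI => by
      simp only [hθ1 t htI]; exact (hoff t ht htI).2
    have h0 : ∫ t in α..β, q 0 t = ∫ t in α..β, (-κ (V t) + f (X t, Y t)) * σ t := by
      refine intervalIntegral.integral_congr fun t ht => ?_
      rw [uIcc_of_le hαβ.le] at ht
      simp only [hq, hYY0 t (hsub ht)]
      simp [hVV, hXX, hs]
    have hqc : ContinuousOn (q ε) (Icc α β) := by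
      have cXε : ContinuousOn (XX ε) (Icc α β) := (slice fun t ht => cXX ht).mono hsub
      have csε : ContinuousOn (s ε) (Icc α β) := (slice fun t ht => cs ht).mono hsub
      have cfW : ContinuousOn f W := fun z hz => (hf z hz).continuousAt.continuousWithinAt
      exact ((κ.continuous.comp_continuousOn (cVε.mono hsub)).neg.add
        (cfW.comp (cXε.prodMk (cYε.mono hsub)) fun t ht => (hε t ht).2)).mul csε
    have h1 : ∫ t in α..β, q ε t =
        ∫ t in α..β, (-κ (VV ε (θ t)) + f (XX ε (θ t), YY ε (θ t))) * σ t := by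
      have hIcc : uIcc α β = Icc α β := uIcc_of_le hαβ.le
      have himg : θ '' uIcc α β ⊆ Icc α β := by
        rw [hIcc]; rintro _ ⟨t, ht, rfl⟩; exact hθ2 t ht
      have := intervalIntegral.integral_comp_mul_deriv'' (f := θ) (g := q ε) (a := α) (b := β)
        (f' := fun t => σ t / s ε (θ t))
        (by rw [hIcc]; exact hθc.mono hsub)
        (fun t ht => by
          rw [min_eq_left hαβ.le, max_eq_right hαβ.le] at ht
          exact (hθd t (hsub (Ioo_subset_Icc_self ht))).hasDerivWithinAt)
        (by
          rw [hIcc]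
          exact (hσ.mono hsub).div (((slice fun t ht => cs ht).comp hθc hθab).mono hsub)
            fun t ht => (hs0 _ (hθab t (hsub ht))).ne')
        (hqc.mono himg)
      rw [hθ1 α (by simp), hθ1 β (by simp)] at this
      rw [← this]
      refine intervalIntegral.integral_congr fun t ht => ?_
      rw [hIcc] at ht
      have := (hs0 _ (hθab t (hsub ht))).ne'
      simp only [Function.comp, hq]
      field_simp
    rw [h0, h1]; exact hcomp
  rw [← hmax.hasDerivAt_eq_zero hderiv]
  refine intervalIntegral.integral_congr fun t ht => ?_
  rw [uIcc_of_le hαβ.le] at ht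
  have h0 := (hσ0 t (hsub ht)).ne'
  have hY' : YY' 0 t = U t - (σ t)⁻¹ • δ' t + (g' t / σ t) • (V t - Y t) := by
    simp only [hYY', hs, hJ, zero_mul, zero_smul, add_zero, smul_smul]
    have : -g' t / σ t ^ 2 * σ t = -(g' t / σ t) := by field_simp
    rw [this, neg_smul]
    abel
  simp only [hq', hYY0 t (hsub ht), hY']
  simp [hXX, hVV, hs]

/-! ### Necessary conditions for the reduced problem -/

namespace IsReducedOptimal

variable {n : ℕ} {κ : (Fin n → ℝ) →L[ℝ] ℝ} {f : (Fin n → ℝ) × (Fin n → ℝ) → ℝ}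
  {f' : (Fin n → ℝ) × (Fin n → ℝ) → (Fin n → ℝ) × (Fin n → ℝ) →L[ℝ] ℝ} {σ : ℝ → ℝ} {a b : ℝ}
  {W : Set ((Fin n → ℝ) × (Fin n → ℝ))} {X Y V : ℝ → Fin n → ℝ}

lemma continuousOn_inventory (hopt : IsReducedOptimal κ f σ a b W X Y V) :
    ContinuousOn X (Ioo a b) := fun t ht =>
  (hopt.flow.hasDerivAt t ht).continuousAt.continuousWithinAt

lemma continuousOn_deriv (hopt : IsReducedOptimal κ f σ a b W X Y V) (hf' : ContinuousOn f' W) :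
    ContinuousOn (fun t => f' (X t, Y t)) (Ioo a b) :=
  hf'.comp (hopt.continuousOn_inventory.prodMk hopt.flow.sales_continuous) hopt.flow.mem

/-- Complementarity of replenishment and its marginal profit.  The squared replenishment is varied
by a multiple of itself, so that it stays nonnegative. -/
lemma inflow_mul_eq_zero (hopt : IsReducedOptimal κ f σ a b W X Y V) (hW : IsOpen W)
    (hf : ∀ z ∈ W, HasFDerivAt f (f' z) z) (hf' : ContinuousOn f' W)
    (hσ : ContinuousOn σ (Ioo a b)) (hσ0 : ∀ t ∈ Ioo a b, 0 < σ t) {t : ℝ} (ht : t ∈ Ioo a b)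
    (i : Fin n) :
    (f' (X t, Y t) (0, Pi.single i 1) - κ (Pi.single i 1)) * V t i = 0 := by
  obtain ⟨α, hα, hαt⟩ := exists_between ht.1
  obtain ⟨β, htβ, hβ⟩ := exists_between ht.2
  have hαβ := hαt.trans htβ
  have hsub : Icc α β ⊆ Ioo a b := fun t ht => ⟨hα.trans_le ht.1, ht.2.trans_lt hβ⟩
  set e : Fin n → ℝ := Pi.single i 1 with he
  have hVi : ContinuousOn (fun t => V t i) (Ioo a b) :=
    (continuous_apply i).comp_continuousOn hopt.flow.inflow_continuous
  set h : ℝ → ℝ := fun t => (f' (X t, Y t) (0, e) - κ e) * V t i with hh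
  have hhc : ContinuousOn h (Ioo a b) :=
    (((hopt.continuousOn_deriv hf').clm_apply continuousOn_const).sub continuousOn_const).mul hVi
  set φ : ℝ → ℝ := fun t => cutoff α β t * h t / σ t with hφ
  have hφc : ContinuousOn φ (Ioo a b) :=
    ((continuous_cutoff α β).continuousOn.mul hhc).div hσ fun t ht => (hσ0 t ht).ne'
  obtain ⟨C, hC⟩ := isCompact_Icc.exists_bound_of_continuousOn (hφc.mono hsub)
  have hpos : ∀ᶠ ε : ℝ in 𝓝 0, ∀ t ∈ Icc α β, 0 ≤ V t + ε • ((φ t * V t i) • e) := by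
    have hlim : Tendsto (fun ε : ℝ => |ε| * C) (𝓝 0) (𝓝 0) := by
      have : Continuous fun ε : ℝ => |ε| * C := by fun_prop
      simpa using this.tendsto 0
    filter_upwards [hlim.eventually_lt_const one_pos] with ε hε s hs j
    have hVs := hopt.flow.inflow_nonneg s (hsub hs)
    rcases eq_or_ne j i with rfl | hj
    · have h1 : |ε * φ s| ≤ 1 := by
        rw [abs_mul]
        exact (mul_le_mul_of_nonneg_left (hC s hs) (abs_nonneg ε)).trans hε.le
      have h2 : 0 ≤ V s j * (1 + ε * φ s) := mul_nonneg (hVs j) (by linarith [neg_abs_le (ε * φ s)])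
      simp only [Pi.zero_apply, Pi.add_apply, Pi.smul_apply, smul_eq_mul, he, Pi.single_eq_same]
      linarith
    · simpa [he, hj] using hVs j
  have key := hopt.first_variation hW hf hf' hσ hσ0 hα hαβ hβ (isTestPair_zero α β)
    (isTestPair_zero α β) (U := fun t => (φ t * V t i) • e)
    ((hφc.mul hVi).smul continuousOn_const)
    (fun s hs => by simp [hφ, cutoff_eq_zero hαβ.le hs]) hpos
  refine eqOn_zero_of_integral_cutoff_mul_sq hαβ (hhc.mono hsub) ?_ t ⟨hαt, htβ⟩
  rw [← key]
  refine intervalIntegral.integral_congr fun s hs => ?_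
  rw [uIcc_of_le hαβ.le] at hs
  have hs0 := (hσ0 s (hsub hs)).ne'
  have hlin : f' (X s, Y s) (0, (φ s * V s i) • e) = φ s * V s i * f' (X s, Y s) (0, e) := by
    rw [← smul_eq_mul (φ s * V s i), ← map_smul, Prod.smul_mk, smul_zero]
  simp only [smul_zero, sub_zero, zero_div, zero_smul, add_zero, mul_zero, map_smul, smul_eq_mul,
    hlin]
  simp only [hφ, hh]
  field_simp
  ring

/-- The Euler–Lagrange equation of the inventory. -/
lemma hasDerivAt_neg_deriv_sales (hopt : IsReducedOptimal κ f σ a b W X Y V) (hW : IsOpen W)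
    (hf : ∀ z ∈ W, HasFDerivAt f (f' z) z) (hf' : ContinuousOn f' W)
    (hσ : ContinuousOn σ (Ioo a b)) (hσ0 : ∀ t ∈ Ioo a b, 0 < σ t) {t : ℝ} (ht : t ∈ Ioo a b)
    (v : Fin n → ℝ) :
    HasDerivAt (fun t => -f' (X t, Y t) (0, v)) (σ t * f' (X t, Y t) (v, 0)) t := by
  obtain ⟨α, hα, hαt⟩ := exists_between ht.1
  obtain ⟨β, htβ, hβ⟩ := exists_between ht.2
  have hαβ := hαt.trans htβ
  have hsub : Icc α β ⊆ Ioo a b := fun t ht => ⟨hα.trans_le ht.1, ht.2.trans_lt hβ⟩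
  have hc := (hopt.continuousOn_deriv hf').mono hsub
  refine hasDerivAt_of_integral_add_eq_zero hαβ
    (A := fun t => σ t * f' (X t, Y t) (v, 0))
    ((hσ.mono hsub).mul (hc.clm_apply continuousOn_const))
    (hc.clm_apply continuousOn_const).neg (fun g g' hg => ?_) t ⟨hαt, htβ⟩
  have key := hopt.first_variation hW hf hf' hσ hσ0 hα hαβ hβ
    (hg.clm_comp ((ContinuousLinearMap.id ℝ ℝ).smulRight v)) (isTestPair_zero α β)
    (U := fun _ => 0) continuousOn_const (fun _ _ => rfl)
    (.of_forall fun ε s hs => by simpa using hopt.flow.inflow_nonneg s (hsub hs))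
  rw [← key]
  refine intervalIntegral.integral_congr fun s hs => ?_
  rw [uIcc_of_le hαβ.le] at hs
  have hs0 := (hσ0 s (hsub hs)).ne'
  have hlin : f' (X s, Y s) (g s • v, -(σ s)⁻¹ • g' s • v) =
      g s * f' (X s, Y s) (v, 0) + -(σ s)⁻¹ * g' s * f' (X s, Y s) (0, v) := by
    rw [← smul_eq_mul (g s), ← smul_eq_mul _ (f' (X s, Y s) (0, v)), ← map_smul, ← map_smul,
      ← map_add, Prod.smul_mk, Prod.smul_mk, smul_zero, smul_zero, Prod.mk_add_mk, add_zero,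
      zero_add, mul_smul]
  simp only [map_zero, neg_zero, zero_add, zero_div, zero_smul, add_zero, mul_zero, zero_sub,
    ContinuousLinearMap.smulRight_apply, ContinuousLinearMap.id_apply, ← neg_smul, hlin,
    Pi.neg_apply]
  field_simp

/-- Conservation of the Hamiltonian, by variation of the seasonal clock. -/
lemma hasDerivAt_hamiltonian (hopt : IsReducedOptimal κ f σ a b W X Y V) (hW : IsOpen W)
    (hf : ∀ z ∈ W, HasFDerivAt f (f' z) z) (hf' : ContinuousOn f' W)
    (hσ : ContinuousOn σ (Ioo a b)) (hσ0 : ∀ t ∈ Ioo a b, 0 < σ t) {t : ℝ} (ht : t ∈ Ioo a b) :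
    HasDerivAt (fun t => f' (X t, Y t) (0, V t - Y t) - κ (V t) + f (X t, Y t)) 0 t := by
  obtain ⟨α, hα, hαt⟩ := exists_between ht.1
  obtain ⟨β, htβ, hβ⟩ := exists_between ht.2
  have hαβ := hαt.trans htβ
  have hsub : Icc α β ⊆ Ioo a b := fun t ht => ⟨hα.trans_le ht.1, ht.2.trans_lt hβ⟩
  have hfc : ContinuousOn (fun t => f (X t, Y t)) (Ioo a b) :=
    ContinuousOn.comp (fun z hz => (hf z hz).continuousAt.continuousWithinAt)
      (hopt.continuousOn_inventory.prodMk hopt.flow.sales_continuous) hopt.flow.mem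
  have hc : ContinuousOn (fun t => f' (X t, Y t) (0, V t - Y t) - κ (V t) + f (X t, Y t))
      (Ioo a b) :=
    (((hopt.continuousOn_deriv hf').clm_apply (continuousOn_const.prodMk
      (hopt.flow.inflow_continuous.sub hopt.flow.sales_continuous))).sub
      (κ.continuous.comp_continuousOn hopt.flow.inflow_continuous)).add hfc
  obtain ⟨k, hk⟩ := exists_eq_const_of_integral_mul_deriv_eq_zero hαβ (hc.mono hsub)
    fun g g' hg => by
      have key := hopt.first_variation hW hf hf' hσ hσ0 hα hαβ hβ (isTestPair_zero α β) hg
        (U := fun _ => 0) continuousOn_const (fun _ _ => rfl)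
        (.of_forall fun ε s hs => by simpa using hopt.flow.inflow_nonneg s (hsub hs))
      rw [← key]
      refine intervalIntegral.integral_congr fun s hs => ?_
      rw [uIcc_of_le hαβ.le] at hs
      have hs0 := (hσ0 s (hsub hs)).ne'
      have hlin : f' (X s, Y s) (0, (g' s / σ s) • (V s - Y s)) =
          g' s / σ s * f' (X s, Y s) (0, V s - Y s) := by
        rw [← smul_eq_mul, ← map_smul, Prod.smul_mk, smul_zero]
      simp only [map_zero, neg_zero, zero_add, smul_zero, sub_zero, hlin]
      field_simp
      ring
  refine (hasDerivAt_const t k).congr_of_eventuallyEq ?_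
  filter_upwards [isOpen_Ioo.mem_nhds (⟨hαt, htβ⟩ : t ∈ Ioo α β)] with s hs using hk s hs

end IsReducedOptimal

/-! ### Sales as controls -/

/-- The linear functional `v ↦ ⟨u, v⟩`. -/
noncomputable def dotCLM {n : ℕ} (u : Fin n → ℝ) : (Fin n → ℝ) →L[ℝ] ℝ :=
  ∑ i, u i • ContinuousLinearMap.proj i

@[simp]
lemma dotCLM_apply {n : ℕ} (u v : Fin n → ℝ) : dotCLM u v = u ⬝ᵥ v := by
  simp [dotCLM, dotProduct]

/-- Near a point at which the demand model is continuously differentiable with invertible price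
derivative, the price is a continuously differentiable function `G` of inventory and sales. -/
lemma exists_price_of_sales {n : ℕ} {S : (Fin n → ℝ) → (Fin n → ℝ) → (Fin n → ℝ)}
    {x₀ q₀ : Fin n → ℝ} (hS : ContDiffAt ℝ 1 (Function.uncurry S) (x₀, q₀))
    (hinj : ∀ v, fderiv ℝ (S x₀) q₀ v = 0 → v = 0)
    (hx₀ : ∀ i, 0 < x₀ i) (hq₀ : ∀ i, 0 < q₀ i) (hs₀ : ∀ i, 0 < S x₀ q₀ i) :
    ∃ (W : Set ((Fin n → ℝ) × (Fin n → ℝ))) (G : (Fin n → ℝ) × (Fin n → ℝ) → Fin n → ℝ),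
      IsOpen W ∧ ContDiffOn ℝ 1 G W ∧
      (∀ z ∈ W, S z.1 (G z) = z.2 ∧ (∀ i, 0 < z.1 i) ∧ (∀ i, 0 < z.2 i) ∧ ∀ i, 0 < G z i) ∧
      ∀ᶠ z in 𝓝 (x₀, q₀), (z.1, S z.1 z.2) ∈ W ∧ G (z.1, S z.1 z.2) = z.2 := by
  set Φ : (Fin n → ℝ) × (Fin n → ℝ) → (Fin n → ℝ) × (Fin n → ℝ) := fun z => (z.1, S z.1 z.2) with hΦ
  have hΦc : ContDiffAt ℝ 1 Φ (x₀, q₀) := contDiffAt_fst.prodMk hS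
  have hSd : HasFDerivAt (Function.uncurry S) (fderiv ℝ (Function.uncurry S) (x₀, q₀)) (x₀, q₀) :=
    (hS.differentiableAt one_ne_zero).hasFDerivAt
  set D := fderiv ℝ (Function.uncurry S) (x₀, q₀) with hD
  have hDp : ∀ v, D (0, v) = fderiv ℝ (S x₀) q₀ v := fun v => by
    have : HasFDerivAt (S x₀) (D.comp (ContinuousLinearMap.inr ℝ _ _)) q₀ :=
      HasFDerivAt.comp (f := fun q => (x₀, q)) q₀ hSd (hasFDerivAt_prodMk_right x₀ q₀)
    rw [this.fderiv]; rfl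
  set A := (ContinuousLinearMap.fst ℝ (Fin n → ℝ) (Fin n → ℝ)).prod D with hA
  have hAinj : Function.Injective A := by
    rw [injective_iff_map_eq_zero]
    rintro ⟨u, v⟩ huv
    have hu : u = 0 := congrArg Prod.fst huv
    have hv : D (u, v) = 0 := congrArg Prod.snd huv
    rw [hu, hDp] at hv
    rw [hu, hinj v hv]; rfl
  set e := (LinearEquiv.ofInjectiveEndo A.toLinearMap hAinj).toContinuousLinearEquiv with he
  have hΦd : HasFDerivAt Φ (e : _ →L[ℝ] _) (x₀, q₀) := by
    have : (e : (Fin n → ℝ) × (Fin n → ℝ) →L[ℝ] (Fin n → ℝ) × (Fin n → ℝ)) = A := by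
      ext v <;> rfl
    rw [this]
    exact hasFDerivAt_fst.prodMk hSd
  set P := hΦc.toOpenPartialHomeomorph Φ hΦd one_ne_zero with hP
  have hPΦ : ∀ z, P z = Φ z := fun z => rfl
  have hmem : (x₀, q₀) ∈ P.source := hΦc.mem_toOpenPartialHomeomorph_source hΦd one_ne_zero
  have hsymm : ContDiffAt ℝ 1 P.symm (Φ (x₀, q₀)) := hΦc.to_localInverse hΦd one_ne_zero
  obtain ⟨O, hO, hO1⟩ := (hsymm.eventually (by simp)).exists_mem
  obtain ⟨O', hO'O, hO'o, hO'm⟩ := mem_nhds_iff.1 hO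
  set G : (Fin n → ℝ) × (Fin n → ℝ) → Fin n → ℝ := fun z => (P.symm z).2 with hG
  have hW₀ : IsOpen (O' ∩ P.target) := hO'o.inter P.open_target
  have hGc : ContDiffOn ℝ 1 G (O' ∩ P.target) := fun z hz =>
    (contDiffAt_snd.comp z (hO1 z (hO'O hz.1))).contDiffWithinAt
  set Q : Set (Fin n → ℝ) := {v | ∀ i, 0 < v i} with hQ
  have hpos : IsOpen Q := by
    simp only [hQ, ofPred_forall]
    exact isOpen_iInter_of_finite fun i => isOpen_lt continuous_const (continuous_apply i)
  refine ⟨((O' ∩ P.target) ∩ G ⁻¹' Q) ∩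
    (Q ×ˢ Q), G,
    (hGc.continuousOn.isOpen_inter_preimage hW₀ hpos).inter (hpos.prod hpos),
    hGc.mono fun z hz => hz.1.1, fun z hz => ⟨?_, hz.2.1, hz.2.2, hz.1.2⟩, ?_⟩
  · have h1 : Φ (P.symm z) = z := P.right_inv hz.1.1.2
    have h2 : (P.symm z).1 = z.1 := (congrArg Prod.fst h1 :)
    have h3 : S (P.symm z).1 (P.symm z).2 = z.2 := (congrArg Prod.snd h1 :)
    rwa [h2] at h3
  · have hinv : ∀ z ∈ P.source, G (Φ z) = z.2 := fun z hz => congrArg Prod.snd (P.left_inv hz)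
    have hsrc := P.open_source.mem_nhds hmem
    filter_upwards [hsrc, hΦc.continuousAt.eventually_mem (hO'o.mem_nhds hO'm),
      hΦc.continuousAt.eventually_mem ((hpos.prod hpos).mem_nhds ⟨hx₀, hs₀⟩),
      (hpos.preimage continuous_snd).mem_nhds hq₀] with z h1 h2 h3 h4
    refine ⟨⟨⟨⟨h2, P.map_source h1⟩, ?_⟩, h3⟩, hinv z h1⟩
    change ∀ i, 0 < G (Φ z) i
    rw [hinv z h1]; exact h4

/-- On a time interval on which prices are a function `G` of inventory and sales, an optimal
trajectory solves the reduced problem with revenue `⟨G(x, y), y⟩`. -/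
lemma IsOptimal.isReducedOptimal {n : ℕ} {S : (Fin n → ℝ) → (Fin n → ℝ) → (Fin n → ℝ)}
    {σ : ℝ → ℝ} {T a b : ℝ} {c I₀ I₁ : Fin n → ℝ} {I p ρ : ℝ → Fin n → ℝ}
    (hopt : IsOptimal S σ T c I₀ I₁ I p ρ) (hσ : ContinuousOn σ (Ioo 0 T))
    (ha : 0 ≤ a) (hb : b ≤ T) {W : Set ((Fin n → ℝ) × (Fin n → ℝ))}
    {G : (Fin n → ℝ) × (Fin n → ℝ) → Fin n → ℝ} (hGc : ContinuousOn G W)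
    (hW : ∀ z ∈ W, S z.1 (G z) = z.2 ∧ (∀ i, 0 < z.1 i) ∧ (∀ i, 0 < z.2 i) ∧ ∀ i, 0 < G z i)
    (hmem : ∀ t ∈ Ioo a b, (I t, S (I t) (p t)) ∈ W)
    (hG : ∀ t ∈ Ioo a b, G (I t, S (I t) (p t)) = p t)
    (hY : ContinuousOn (fun t => S (I t) (p t)) (Ioo a b)) :
    IsReducedOptimal (dotCLM c) (fun z => G z ⬝ᵥ z.2) σ a b W I (fun t => S (I t) (p t))
      (fun t => ρ t ^ 2) := by
  obtain ⟨hadm, hmax⟩ := hopt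
  have habT : Ioo a b ⊆ Ioo 0 T := Ioo_subset_Ioo ha hb
  refine ⟨⟨fun t ht => ?_, hY, (hadm.replenishment_continuous.mono habT).pow 2, hmem,
    fun t _ i => sq_nonneg _⟩, fun α β X Y V hα hαβ hβ hflow hagree => ?_⟩
  · refine (hadm.flow t (habT ht)).congr_deriv ?_
    rw [smul_sub]; abel
  have hXc : ContinuousOn X (Ioo a b) := fun t ht =>
    (hflow.hasDerivAt t ht).continuousAt.continuousWithinAt
  have hsub : Icc α β ⊆ Ioo a b := fun t ht => ⟨hα.trans_le ht.1, ht.2.trans_lt hβ⟩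
  classical
  set I' : ℝ → Fin n → ℝ := fun t => if t ∈ Ioo a b then X t else I t with hI'
  set p' : ℝ → Fin n → ℝ := fun t => if t ∈ Ioo a b then G (X t, Y t) else p t with hp'
  set ρ' : ℝ → Fin n → ℝ := fun t => if t ∈ Ioo a b then fun i => √(V t i) else ρ t with hρ'
  have hin : ∀ t ∈ Ioo a b, I' t = X t ∧ p' t = G (X t, Y t) ∧ ρ' t = fun i => √(V t i) :=
    fun t ht => by simp only [hI', hp', hρ', if_pos ht, and_self]
  have hout : ∀ t, t ∉ Ioo α β → I' t = I t ∧ p' t = p t ∧ ρ' t = ρ t := fun t ht => by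
    by_cases htab : t ∈ Ioo a b
    · obtain ⟨h1, h2, h3⟩ := hin t htab
      obtain ⟨g1, g2, g3⟩ := hagree t htab ht
      rw [h1, h2, h3, g1, g2, g3, hG t htab]
      refine ⟨rfl, rfl, funext fun i => ?_⟩
      exact Real.sqrt_sq (hadm.replenishment_nonneg t (habT htab) i)
    · simp only [hI', hp', hρ', if_neg htab, and_self]
  have hS' : ∀ t ∈ Ioo a b, S (I' t) (p' t) = Y t := fun t ht => by
    rw [(hin t ht).1, (hin t ht).2.1]; exact (hW _ (hflow.mem t ht)).1
  have hρ2 : ∀ t ∈ Ioo a b, ρ' t ^ 2 = V t := fun t ht => by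
    rw [(hin t ht).2.2]; exact funext fun i => Real.sq_sqrt (hflow.inflow_nonneg t ht i)
  have evin : ∀ t ∈ Ioo a b, ∀ᶠ s in 𝓝 t, s ∈ Ioo a b := fun t ht => isOpen_Ioo.mem_nhds ht
  have evout : ∀ t, t ∉ Ioo a b → ∀ᶠ s in 𝓝 t, s ∉ Ioo α β := fun t ht => by
    filter_upwards [isClosed_Icc.isOpen_compl.mem_nhds fun h => ht (hsub h)] with s hs
    exact fun h => hs (Ioo_subset_Icc_self h)
  have hGXY : ContinuousOn (fun t => G (X t, Y t)) (Ioo a b) :=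
    hGc.comp (hXc.prodMk hflow.sales_continuous) hflow.mem
  have h0T : ∀ t, t ∉ Ioo 0 T → t ∉ Ioo α β := fun t ht h => ht (habT (hsub (Ioo_subset_Icc_self h)))
  -- the integrands of the two profits
  set J : ℝ → ℝ := fun t => (-(c ⬝ᵥ (ρ t) ^ 2) + p t ⬝ᵥ S (I t) (p t)) * σ t with hJ
  set J' : ℝ → ℝ := fun t => (-(c ⬝ᵥ (ρ' t) ^ 2) + p' t ⬝ᵥ S (I' t) (p' t)) * σ t with hJ'
  have hJout : ∀ t, t ∉ Ioo α β → J t = J' t := fun t ht => by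
    simp only [hJ, hJ', (hout t ht).1, (hout t ht).2.1, (hout t ht).2.2]
  have hJin : EqOn J (fun t => (-(dotCLM c) (ρ t ^ 2) +
      G (I t, S (I t) (p t)) ⬝ᵥ S (I t) (p t)) * σ t) (Icc α β) := fun t ht => by
    simp only [hJ, hG t (hsub ht), dotCLM_apply]
  have hJ'in : EqOn J' (fun t => (-(dotCLM c) (V t) + G (X t, Y t) ⬝ᵥ Y t) * σ t) (Icc α β) :=
    fun t ht => by
      simp only [hJ', hρ2 t (hsub ht), hS' t (hsub ht), dotCLM_apply]
      rw [(hin t (hsub ht)).2.1]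
  have hα0 : 0 ≤ α := ha.trans hα.le
  have hβT : β ≤ T := hβ.le.trans hb
  have hJint := hadm.profit_integrable
  have hT0 : (0 : ℝ) ≤ T := hα0.trans (hαβ.le.trans hβT)
  have hJ1 : IntervalIntegrable J volume 0 α := hJint.mono_set <| by
    rw [uIcc_of_le hα0, uIcc_of_le hT0]; exact Icc_subset_Icc_right (hαβ.le.trans hβT)
  have hJ2 : IntervalIntegrable J volume α β := hJint.mono_set <| by
    rw [uIcc_of_le hαβ.le, uIcc_of_le hT0]; exact Icc_subset_Icc hα0 hβT
  have hJ3 : IntervalIntegrable J volume β T := hJint.mono_set <| by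
    rw [uIcc_of_le hβT, uIcc_of_le hT0]; exact Icc_subset_Icc_left (hα0.trans hαβ.le)
  have heq1 : EqOn J J' (uIcc 0 α) := fun t ht => by
    rw [uIcc_of_le hα0] at ht
    exact hJout t fun h => h.1.not_ge ht.2
  have heq3 : EqOn J J' (uIcc β T) := fun t ht => by
    rw [uIcc_of_le hβT] at ht
    exact hJout t fun h => h.2.not_ge ht.1
  have hJ'1 : IntervalIntegrable J' volume 0 α := hJ1.congr fun t ht => heq1 (uIoc_subset_uIcc ht)
  have hJ'3 : IntervalIntegrable J' volume β T := hJ3.congr fun t ht => heq3 (uIoc_subset_uIcc ht)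
  have hJ'2 : IntervalIntegrable J' volume α β := by
    refine ContinuousOn.intervalIntegrable ?_
    rw [uIcc_of_le hαβ.le]
    refine ContinuousOn.congr ?_ hJ'in
    exact (((dotCLM c).continuous.comp_continuousOn (hflow.inflow_continuous.mono hsub)).neg.add
      ((continuous_fst.dotProduct continuous_snd).comp_continuousOn
        ((hGXY.mono hsub).prodMk (hflow.sales_continuous.mono hsub)))).mul
      (hσ.mono (hsub.trans habT))
  have hadm' : IsAdmissible S σ T c I₀ I₁ I' p' ρ' := by
    refine ⟨fun t ht => ?_, fun t ht => ?_, fun t ht => ?_, fun t ht => ?_, ?_, ?_, fun t ht => ?_,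
      fun t ht => ?_, fun t ht => ?_, fun t ht => ?_, (hJ'1.trans hJ'2).trans hJ'3⟩
    · by_cases hab : t ∈ Ioo a b
      · exact ((hXc.continuousAt (isOpen_Ioo.mem_nhds hab)).congr
          ((evin t hab).mono fun s hs => (hin s hs).1.symm)).continuousWithinAt
      · exact (hadm.inventory_continuous t ht).congr_of_eventuallyEq
          (((evout t hab).mono fun s hs => (hout s hs).1).filter_mono nhdsWithin_le_nhds)
          (hout t fun h => hab (hsub (Ioo_subset_Icc_self h))).1
    · by_cases hab : t ∈ Ioo a b
      · exact ((hGXY.continuousAt (isOpen_Ioo.mem_nhds hab)).congr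
          ((evin t hab).mono fun s hs => (hin s hs).2.1.symm)).continuousWithinAt
      · exact (hadm.price_continuous t ht).congr_of_eventuallyEq
          (((evout t hab).mono fun s hs => (hout s hs).2.1).filter_mono nhdsWithin_le_nhds)
          (hout t fun h => hab (hsub (Ioo_subset_Icc_self h))).2.1
    · by_cases hab : t ∈ Ioo a b
      · have hVc : ContinuousAt (fun s => fun i => √(V s i)) t :=
          continuousAt_pi.2 fun i => Real.continuous_sqrt.continuousAt.comp
            (continuousAt_pi.1 (hflow.inflow_continuous.continuousAt (isOpen_Ioo.mem_nhds hab)) i)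
        exact (hVc.congr ((evin t hab).mono fun s hs => (hin s hs).2.2.symm)).continuousWithinAt
      · exact (hadm.replenishment_continuous t ht).congr_of_eventuallyEq
          (((evout t hab).mono fun s hs => (hout s hs).2.2).filter_mono nhdsWithin_le_nhds)
          (hout t fun h => hab (hsub (Ioo_subset_Icc_self h))).2.2
    · by_cases hab : t ∈ Ioo a b
      · rw [hS' t hab, hρ2 t hab]
        refine ((hflow.hasDerivAt t hab).congr_of_eventuallyEq
          ((evin t hab).mono fun s hs => (hin s hs).1)).congr_deriv ?_
        rw [smul_sub]; abel
      · obtain ⟨h1, h2, h3⟩ := hout t fun h => hab (hsub (Ioo_subset_Icc_self h))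
        rw [h1, h2, h3]
        exact (hadm.flow t ht).congr_of_eventuallyEq
          ((evout t hab).mono fun s hs => (hout s hs).1)
    · rw [(hout 0 (h0T 0 (by simp))).1, hadm.initial]
    · rw [(hout T (h0T T (by simp))).1, hadm.terminal]
    · by_cases hab : t ∈ Ioo a b
      · rw [(hin t hab).1]; exact (hW _ (hflow.mem t hab)).2.1
      · rw [(hout t fun h => hab (hsub (Ioo_subset_Icc_self h))).1]; exact hadm.inventory_pos t ht
    · by_cases hab : t ∈ Ioo a b
      · rw [(hin t hab).2.1]; exact (hW _ (hflow.mem t hab)).2.2.2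
      · rw [(hout t fun h => hab (hsub (Ioo_subset_Icc_self h))).2.1]; exact hadm.price_pos t ht
    · by_cases hab : t ∈ Ioo a b
      · rw [hS' t hab]; exact (hW _ (hflow.mem t hab)).2.2.1
      · obtain ⟨h1, h2, -⟩ := hout t fun h => hab (hsub (Ioo_subset_Icc_self h))
        rw [h1, h2]; exact hadm.sales_pos t ht
    · by_cases hab : t ∈ Ioo a b
      · rw [(hin t hab).2.2]; exact fun i => Real.sqrt_nonneg _
      · rw [(hout t fun h => hab (hsub (Ioo_subset_Icc_self h))).2.2]
        exact hadm.replenishment_nonneg t ht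
  have hle : ∫ t in (0 : ℝ)..T, J' t ≤ ∫ t in (0 : ℝ)..T, J t := hmax I' p' ρ' hadm'
  rw [← intervalIntegral.integral_add_adjacent_intervals (hJ1.trans hJ2) hJ3,
    ← intervalIntegral.integral_add_adjacent_intervals hJ1 hJ2,
    ← intervalIntegral.integral_add_adjacent_intervals (hJ'1.trans hJ'2) hJ'3,
    ← intervalIntegral.integral_add_adjacent_intervals hJ'1 hJ'2,
    ← intervalIntegral.integral_congr heq1, ← intervalIntegral.integral_congr heq3] at hle
  have heq2 := intervalIntegral.integral_congr (μ := volume) (by rwa [uIcc_of_le hαβ.le] :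
    EqOn J _ (uIcc α β))
  have heq2' := intervalIntegral.integral_congr (μ := volume) (by rwa [uIcc_of_le hαβ.le] :
    EqOn J' _ (uIcc α β))
  rw [heq2, heq2'] at hle
  linarith

/-! ### The Euler–Lagrange equations -/

lemma continuous_dotCLM {n : ℕ} : Continuous (dotCLM : (Fin n → ℝ) → (Fin n → ℝ) →L[ℝ] ℝ) := by
  unfold dotCLM; fun_prop

lemma hasFDerivAt_dotProduct {n : ℕ} {F : Type*} [NormedAddCommGroup F] [NormedSpace ℝ F]
    {u v : F → Fin n → ℝ} {u' v' : F →L[ℝ] Fin n → ℝ} {z : F} (hu : HasFDerivAt u u' z)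
    (hv : HasFDerivAt v v' z) :
    HasFDerivAt (fun z => u z ⬝ᵥ v z) ((dotCLM (u z)).comp v' + (dotCLM (v z)).comp u') z := by
  have := HasFDerivAt.fun_sum (u := Finset.univ) fun i _ =>
    (hasFDerivAt_pi'.1 hu i).fun_mul (hasFDerivAt_pi'.1 hv i)
  refine this.congr_fderiv ?_
  ext w
  simp [dotProduct, Finset.sum_add_distrib]

lemma sum_apply_single_smul_proj {n : ℕ} (L : (Fin n → ℝ) →L[ℝ] ℝ) :
    ∑ i, L (Pi.single i 1) • ContinuousLinearMap.proj (R := ℝ) (φ := fun _ : Fin n => ℝ) i = L := by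
  ext w
  conv_rhs => rw [← Finset.univ_sum_single w, map_sum]
  rw [_root_.sum_apply]
  refine Finset.sum_congr rfl fun i _ => ?_
  have : (Pi.single i (w i) : Fin n → ℝ) = w i • Pi.single i 1 := by
    rw [← Pi.single_smul, smul_eq_mul, mul_one]
  rw [this, map_smul, _root_.smul_apply, ContinuousLinearMap.proj_apply, smul_eq_mul, smul_eq_mul,
    mul_comm]

/-- The first-order condition `∂L/∂p = 0` at inventory `x`, price `q` and multiplier `l`, divided
by the seasonality: `⟨v, S⟩ + ⟨q + l, (∂S/∂p) v⟩ = 0` for all `v`. -/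
def PriceEquation {n : ℕ} (S : (Fin n → ℝ) → (Fin n → ℝ) → (Fin n → ℝ)) (x q l : Fin n → ℝ) :
    Prop :=
  ∀ v, v ⬝ᵥ S x q + (q + l) ⬝ᵥ fderiv ℝ (S x) q v = 0

section Pointwise

variable {n : ℕ} {S : (Fin n → ℝ) → (Fin n → ℝ) → (Fin n → ℝ)} {c x v q r l : Fin n → ℝ} {s : ℝ}

lemma hasFDerivAt_lagrangian_price (hS : DifferentiableAt ℝ (S x) q) :
    HasFDerivAt (fun q => lagrangian S c s x v q r l)
      (s • (dotCLM (S x q) + (dotCLM (q + l)).comp (fderiv ℝ (S x) q))) q := by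
  have h1 := (hasFDerivAt_dotProduct (hasFDerivAt_id q) hS.hasFDerivAt).mul_const s
  have h2 := hasFDerivAt_dotProduct (hasFDerivAt_const l q)
    (((hS.hasFDerivAt.fun_const_smul s).const_add v).sub_const (s • r ^ 2))
  refine ((h1.const_add (-(c ⬝ᵥ r ^ 2) * s)).fun_add h2).congr_fderiv ?_
  ext w
  simp [add_dotProduct]
  ring

lemma hasFDerivAt_lagrangian_price_zero_iff (hS : DifferentiableAt ℝ (S x) q) (hs : s ≠ 0) :
    HasFDerivAt (fun q => lagrangian S c s x v q r l) (0 : (Fin n → ℝ) →L[ℝ] ℝ) q ↔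
      PriceEquation S x q l := by
  have h := hasFDerivAt_lagrangian_price (c := c) (v := v) (r := r) (l := l) (s := s) hS
  refine ⟨fun h0 w => ?_, fun hl => h.congr_fderiv ?_⟩
  · have := DFunLike.congr_fun (h.unique h0) w
    simp only [_root_.smul_apply, _root_.add_apply, ContinuousLinearMap.comp_apply,
      dotCLM_apply, _root_.zero_apply, smul_eq_mul, mul_eq_zero, hs, false_or] at this
    rwa [dotProduct_comm w]
  · ext w
    have := hl w
    rw [dotProduct_comm] at this
    simp only [_root_.smul_apply, _root_.add_apply, ContinuousLinearMap.comp_apply,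
      dotCLM_apply, _root_.zero_apply, smul_eq_mul, this, mul_zero]

lemma hasFDerivAt_lagrangian_inventory (hS : DifferentiableAt ℝ (fun x => S x q) x) :
    HasFDerivAt (fun x => lagrangian S c s x v q r l)
      (s • (dotCLM (q + l)).comp (fderiv ℝ (fun x => S x q) x)) x := by
  have h1 := (hasFDerivAt_dotProduct (hasFDerivAt_const q x) hS.hasFDerivAt).mul_const s
  have h2 := hasFDerivAt_dotProduct (hasFDerivAt_const l x)
    (((hS.hasFDerivAt.fun_const_smul s).const_add v).sub_const (s • r ^ 2))
  refine ((h1.const_add (-(c ⬝ᵥ r ^ 2) * s)).fun_add h2).congr_fderiv ?_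
  ext w
  simp [add_dotProduct]
  ring

lemma fderiv_lagrangian_velocity :
    fderiv ℝ (fun v => lagrangian S c s x v q r l) v = dotCLM l := by
  have h := hasFDerivAt_dotProduct (hasFDerivAt_const l v)
    (((hasFDerivAt_id v).add_const (s • S x q)).sub_const (s • r ^ 2))
  refine ((h.const_add (-(c ⬝ᵥ r ^ 2) * s + (q ⬝ᵥ S x q) * s)).congr_fderiv ?_).fderiv
  ext w
  simp

lemma hasFDerivAt_lagrangian_replenishment (hr : ∀ i, (c i + l i) * r i = 0) :
    HasFDerivAt (fun r => lagrangian S c s x v q r l) (0 : (Fin n → ℝ) →L[ℝ] ℝ) r := by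
  have hpow : HasFDerivAt (fun r : Fin n → ℝ => r ^ 2)
      (ContinuousLinearMap.pi fun i => (2 * r i) •
        ContinuousLinearMap.proj (R := ℝ) (φ := fun _ : Fin n => ℝ) i) r := by
    refine hasFDerivAt_pi.2 fun i => ?_
    refine ((ContinuousLinearMap.proj (R := ℝ) (φ := fun _ : Fin n => ℝ) i).hasFDerivAt.pow
      2).congr_fderiv ?_
    ext w
    simp
  have h1 := (hasFDerivAt_dotProduct (hasFDerivAt_const c r) hpow).fun_neg.mul_const s
  have h2 := hasFDerivAt_dotProduct (hasFDerivAt_const l r)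
    ((hpow.fun_const_smul s).const_sub (v + s • S x q))
  refine ((h1.add_const ((q ⬝ᵥ S x q) * s)).fun_add h2).congr_fderiv ?_
  ext w
  simp only [dotProduct, Finset.mul_sum, _root_.add_apply,
    _root_.smul_apply, _root_.neg_apply, ContinuousLinearMap.comp_apply,
    dotCLM_apply, _root_.zero_apply, ContinuousLinearMap.coe_pi',
    ContinuousLinearMap.proj_apply, smul_eq_mul, Pi.neg_apply, Pi.smul_apply,
    Pi.zero_apply, ← Finset.sum_neg_distrib, ← Finset.sum_add_distrib]
  refine Finset.sum_eq_zero fun i _ => ?_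
  linear_combination (-2 * s * w i) * hr i

lemma elasticity_mulVec (z : Fin n → ℝ) :
    elasticity S x q *ᵥ z = (S x q)⁻¹ * fderiv ℝ (S x) q (q * z) := by
  ext i
  have h := LinearMap.pi_apply_eq_sum_univ (fderiv ℝ (S x) q).toLinearMap (q * z)
  simp only [ContinuousLinearMap.coe_coe] at h
  rw [Pi.mul_apply, h, Finset.sum_apply, Finset.mul_sum]
  change ∑ j, elasticity S x q i j * z j = _
  refine Finset.sum_congr rfl fun j _ => ?_
  have : (fun k => if j = k then (1 : ℝ) else 0) = Pi.single j 1 := by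
    ext k; simp [Pi.single_apply, eq_comm]
  simp only [elasticity, of_apply, this, Pi.smul_apply, Pi.mul_apply, Pi.inv_apply, smul_eq_mul]
  ring

lemma fderiv_price_injective (hΓ : IsUnit (elasticity S x q).det) (hq : ∀ i, 0 < q i)
    (w : Fin n → ℝ) (hw : fderiv ℝ (S x) q w = 0) : w = 0 := by
  have hinj := mulVec_injective_iff_isUnit.2 ((isUnit_iff_isUnit_det _).2 hΓ)
  have hqw : q * (w / q) = w := funext fun i => mul_div_cancel₀ _ (hq i).ne'
  have h0 : w / q = 0 := hinj <| by
    simp only [elasticity_mulVec, hqw, hw, mul_zero, map_zero]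
  rw [← hqw, h0, mul_zero]

lemma exists_priceEquation (hΓ : IsUnit (elasticity S x q).det) (hq : ∀ i, 0 < q i) :
    ∃ l, PriceEquation S x q l := by
  set M := LinearMap.toMatrix' (fderiv ℝ (S x) q).toLinearMap with hM
  have hMv : ∀ w, M *ᵥ w = fderiv ℝ (S x) q w := fun w => by
    rw [hM, LinearMap.toMatrix'_mulVec]; rfl
  have hu : IsUnit M := mulVec_injective_iff_isUnit.1 fun w₁ w₂ hw => sub_eq_zero.1 <|
    fderiv_price_injective hΓ hq _ <| by
      rw [map_sub, ← hMv, ← hMv]; exact sub_eq_zero.2 hw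
  refine ⟨-q - S x q ᵥ* M⁻¹, fun w => ?_⟩
  rw [← hMv, add_sub, add_neg_cancel, zero_sub, neg_dotProduct, ← dotProduct_mulVec,
    mulVec_mulVec, nonsing_inv_mul _ ((isUnit_iff_isUnit_det _).1 hu), one_mulVec,
    dotProduct_comm, add_neg_cancel]

/-- The price equation eliminates the multiplier from the Hamiltonian: it is applied to the price
change that would make sales equal to replenishment to first order. -/
lemma PriceEquation.hamiltonianQuantity_eq (hl : PriceEquation S x q l)
    (hΓ : IsUnit (elasticity S x q).det) (hS : ∀ i, 0 < S x q i) :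
    hamiltonianQuantity S c x q r l = salesInvariant S c x q r := by
  set z := (elasticity S x q)⁻¹ *ᵥ (1 - r ^ 2 / S x q) with hz
  have h1 : (S x q)⁻¹ * fderiv ℝ (S x) q (q * z) = 1 - r ^ 2 / S x q := by
    rw [← elasticity_mulVec, hz, mulVec_mulVec, mul_nonsing_inv _ hΓ, one_mulVec]
  have h2 : fderiv ℝ (S x) q (q * z) = S x q - r ^ 2 := by
    ext i
    have := congrFun h1 i
    have hi := (hS i).ne'
    simp only [Pi.mul_apply, Pi.inv_apply, Pi.sub_apply, Pi.one_apply, Pi.div_apply] at this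
    field_simp at this
    simpa using this
  have h3 := hl (q * z)
  rw [h2] at h3
  have h4 : (q * S x q) ⬝ᵥ z = (q * z) ⬝ᵥ S x q :=
    Finset.sum_congr rfl fun i _ => by simp only [Pi.mul_apply]; ring
  rw [hamiltonianQuantity, salesInvariant, ← hz, h4]
  simp only [add_dotProduct, sub_dotProduct, dotProduct_sub] at h3 ⊢
  linarith

/-- The partial derivatives of the revenue `⟨G(x, y), y⟩`, as a function of inventory and sales, in
terms of the multiplier. -/
lemma PriceEquation.revenue_deriv (hl : PriceEquation S x q l)
    (hS : DifferentiableAt ℝ (Function.uncurry S) (x, q))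
    {W : Set ((Fin n → ℝ) × (Fin n → ℝ))} {G : (Fin n → ℝ) × (Fin n → ℝ) → Fin n → ℝ}
    (hW : IsOpen W) (hSG : ∀ z ∈ W, S z.1 (G z) = z.2) (hmem : (x, S x q) ∈ W)
    (hG : G (x, S x q) = q) (hGd : DifferentiableAt ℝ G (x, S x q)) (u w : Fin n → ℝ) :
    q ⬝ᵥ w + S x q ⬝ᵥ fderiv ℝ G (x, S x q) (u, w) =
      -(l ⬝ᵥ w) + (q + l) ⬝ᵥ fderiv ℝ (fun x => S x q) x u := by
  set D := fderiv ℝ (Function.uncurry S) (x, q) with hD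
  have hDp : fderiv ℝ (S x) q = D.comp (ContinuousLinearMap.inr ℝ _ _) :=
    (HasFDerivAt.comp (f := fun q => (x, q)) q hS.hasFDerivAt
      (hasFDerivAt_prodMk_right x q)).fderiv
  have hDx : fderiv ℝ (fun x => S x q) x = D.comp (ContinuousLinearMap.inl ℝ _ _) :=
    (HasFDerivAt.comp (f := fun x => (x, q)) x hS.hasFDerivAt
      (hasFDerivAt_prodMk_left x q)).fderiv
  set g := fderiv ℝ G (x, S x q) with hg
  have hcomp : HasFDerivAt (fun z => S z.1 (G z))
      (D.comp ((ContinuousLinearMap.fst ℝ (Fin n → ℝ) (Fin n → ℝ)).prod g)) (x, S x q) := by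
    refine HasFDerivAt.comp (g := Function.uncurry S)
      (f := fun z : (Fin n → ℝ) × (Fin n → ℝ) => (z.1, G z)) (x, S x q) ?_
      (hasFDerivAt_fst.prodMk hGd.hasFDerivAt)
    simpa only [hG] using hS.hasFDerivAt
  have hsnd : HasFDerivAt (fun z => S z.1 (G z))
      (ContinuousLinearMap.snd ℝ (Fin n → ℝ) (Fin n → ℝ)) (x, S x q) :=
    hasFDerivAt_snd.congr_of_eventuallyEq
      (by filter_upwards [hW.mem_nhds hmem] with z hz using hSG z hz)
  have h1 : D (u, g (u, w)) = w := DFunLike.congr_fun (hcomp.unique hsnd) (u, w)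
  have h2 : D (u, g (u, w)) = fderiv ℝ (fun x => S x q) x u + fderiv ℝ (S x) q (g (u, w)) := by
    rw [hDp, hDx]
    simp only [ContinuousLinearMap.comp_apply, ContinuousLinearMap.inl_apply,
      ContinuousLinearMap.inr_apply, ← map_add, Prod.mk_add_mk, add_zero, zero_add]
  have h3 := hl (g (u, w))
  rw [eq_sub_of_add_eq' (h2.symm.trans h1), dotProduct_sub, dotProduct_comm] at h3
  simp only [add_dotProduct] at h3 ⊢
  linarith

end Pointwise

/-- The Euler–Lagrange equations of the replenishment and of the inventory, and the conservation
law, at an inner time of an optimal trajectory, for any solution of the price equation. -/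
lemma IsOptimal.necessary_conditions {n : ℕ} {S : (Fin n → ℝ) → (Fin n → ℝ) → (Fin n → ℝ)}
    {σ : ℝ → ℝ} {T : ℝ} {c I₀ I₁ : Fin n → ℝ} {I p ρ l : ℝ → Fin n → ℝ}
    (hopt : IsOptimal S σ T c I₀ I₁ I p ρ) (hσ : ContinuousOn σ (Ioo 0 T))
    (hσ0 : ∀ t ∈ Ioo 0 T, 0 < σ t)
    (hS : ∀ t ∈ Ioo 0 T, ContDiffAt ℝ 1 (Function.uncurry S) (I t, p t))
    (hΓ : ∀ t ∈ Ioo 0 T, IsUnit (elasticity S (I t) (p t)).det)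
    (hl : ∀ t ∈ Ioo 0 T, PriceEquation S (I t) (p t) (l t)) {t : ℝ} (ht : t ∈ Ioo 0 T) :
    (∀ i, (c i + l t i) * ρ t i = 0) ∧
      (∀ v, HasDerivAt (fun t => l t ⬝ᵥ v)
        (σ t * ((p t + l t) ⬝ᵥ fderiv ℝ (fun x => S x (p t)) (I t) v)) t) ∧
      HasDerivAt (fun t => hamiltonianQuantity S c (I t) (p t) (ρ t) (l t)) 0 t := by
  have hadm := hopt.1
  have hIc : ∀ s ∈ Ioo 0 T, ContinuousAt I s := fun s hs => (hadm.flow s hs).continuousAt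
  have hpc : ∀ s ∈ Ioo 0 T, ContinuousAt p s := fun s hs =>
    hadm.price_continuous.continuousAt (isOpen_Ioo.mem_nhds hs)
  obtain ⟨W, G, hW, hGc, hWG, hev⟩ := exists_price_of_sales (hS t ht)
    (fderiv_price_injective (hΓ t ht) (hadm.price_pos t ht)) (hadm.inventory_pos t ht)
    (hadm.price_pos t ht) (hadm.sales_pos t ht)
  obtain ⟨a, b, htab, hab⟩ := mem_nhds_iff_exists_Ioo_subset.1
    (inter_mem (isOpen_Ioo.mem_nhds ht) (((hIc t ht).prodMk (hpc t ht)).eventually hev))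
  have habT : Ioo a b ⊆ Ioo 0 T := fun s hs => (hab hs).1
  obtain ⟨ha, hb⟩ := (Ioo_subset_Ioo_iff (htab.1.trans htab.2)).1 habT
  have hYc : ContinuousOn (fun t => S (I t) (p t)) (Ioo a b) := fun s hs =>
    (ContinuousAt.comp (f := fun t => (I t, p t)) (hS s (habT hs)).continuousAt
      ((hIc s (habT hs)).prodMk (hpc s (habT hs)))).continuousWithinAt
  have hred := hopt.isReducedOptimal hσ ha hb hGc.continuousOn hWG (fun s hs => (hab hs).2.1)
    (fun s hs => (hab hs).2.2) hYc
  set f' : (Fin n → ℝ) × (Fin n → ℝ) → (Fin n → ℝ) × (Fin n → ℝ) →L[ℝ] ℝ := fun z =>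
    (dotCLM (G z)).comp (ContinuousLinearMap.snd ℝ _ _) + (dotCLM z.2).comp (fderiv ℝ G z) with hf'
  have hGd : ∀ z ∈ W, DifferentiableAt ℝ G z := fun z hz =>
    (hGc.contDiffAt (hW.mem_nhds hz)).differentiableAt one_ne_zero
  have hfd : ∀ z ∈ W, HasFDerivAt (fun z => G z ⬝ᵥ z.2) (f' z) z := fun z hz =>
    hasFDerivAt_dotProduct (hGd z hz).hasFDerivAt hasFDerivAt_snd
  have hfc : ContinuousOn f' W :=
    ((continuous_dotCLM.comp_continuousOn hGc.continuousOn).clm_comp continuousOn_const).add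
      ((continuous_dotCLM.comp continuous_snd).continuousOn.clm_comp
        (hGc.continuousOn_fderiv_of_isOpen hW le_rfl))
  have hval : ∀ s ∈ Ioo a b, ∀ u w, f' (I s, S (I s) (p s)) (u, w) =
      -(l s ⬝ᵥ w) + (p s + l s) ⬝ᵥ fderiv ℝ (fun x => S x (p s)) (I s) u := fun s hs u w => by
    obtain ⟨hs1, hs2⟩ := (hab hs).2
    rw [← (hl s (habT hs)).revenue_deriv ((hS s (habT hs)).differentiableAt one_ne_zero) hW
      (fun z hz => (hWG z hz).1) hs1 hs2 (hGd _ hs1)]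
    simp only [hf', _root_.add_apply, ContinuousLinearMap.comp_apply, dotCLM_apply,
      ContinuousLinearMap.coe_snd']
    rw [show G (I s, S (I s) (p s)) = p s from hs2]
  have hσab := hσ.mono habT
  have hσ0ab : ∀ s ∈ Ioo a b, 0 < σ s := fun s hs => hσ0 s (habT hs)
  have hnhds : ∀ᶠ s in 𝓝 t, s ∈ Ioo a b := isOpen_Ioo.mem_nhds htab
  refine ⟨fun i => ?_, fun v => ?_, ?_⟩
  · have h := hred.inflow_mul_eq_zero hW hfd hfc hσab hσ0ab htab i
    rw [hval t htab] at h
    simp only [map_zero, dotProduct_zero, add_zero, dotCLM_apply, dotProduct_single_one,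
      Pi.pow_apply] at h
    rcases mul_eq_zero.1 h with h | h
    · rw [show c i + l t i = 0 by linarith, zero_mul]
    · rw [pow_eq_zero_iff two_ne_zero |>.1 h, mul_zero]
  · have h := hred.hasDerivAt_neg_deriv_sales hW hfd hfc hσab hσ0ab htab v
    rw [hval t htab, dotProduct_zero, neg_zero, zero_add] at h
    refine h.congr_of_eventuallyEq (hnhds.mono fun s hs => ?_)
    simp [hval s hs]
  · have h := (hred.hasDerivAt_hamiltonian hW hfd hfc hσab hσ0ab htab).fun_neg
    rw [neg_zero] at h
    refine h.congr_of_eventuallyEq (hnhds.mono fun s hs => ?_)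
    simp only [hval s hs, map_zero, dotProduct_zero, add_zero, dotCLM_apply, hamiltonianQuantity]
    rw [show G (I s, S (I s) (p s)) = p s from (hab hs).2.2]
    simp only [add_dotProduct, dotProduct_sub]
    ring

end RetailPricing

theorem theorem2 {n : ℕ} (S : (Fin n → ℝ) → (Fin n → ℝ) → (Fin n → ℝ)) (σ : ℝ → ℝ) (T : ℝ)
    (c I₀ I₁ : Fin n → ℝ) (I p ρ : ℝ → Fin n → ℝ)
    (hT : 0 < T) (hc : ∀ i, 0 ≤ c i)
    (hσ_cont : ContinuousOn σ (Set.Ioo 0 T)) (hσ_pos : ∀ t ∈ Set.Ioo 0 T, 0 < σ t)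
    (hσ_one : ∫ t in (0 : ℝ)..T, σ t = 1)
    (hopt : RetailPricing.IsOptimal S σ T c I₀ I₁ I p ρ)
    (hS : ∀ t ∈ Set.Ioo 0 T, ContDiffAt ℝ 1 (Function.uncurry S) (I t, p t))
    (hΓ : ∀ t ∈ Set.Ioo 0 T, IsUnit (RetailPricing.elasticity S (I t) (p t)).det) :
    (∃ l : ℝ → Fin n → ℝ, RetailPricing.IsMultiplier S σ T c I p ρ l) ∧
    (∀ l : ℝ → Fin n → ℝ, RetailPricing.IsMultiplier S σ T c I p ρ l →
      (∃ C : ℝ, ∀ t ∈ Set.Ioo 0 T,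
        RetailPricing.hamiltonianQuantity S c (I t) (p t) (ρ t) (l t) = C) ∧
      (∀ t ∈ Set.Ioo 0 T,
        RetailPricing.hamiltonianQuantity S c (I t) (p t) (ρ t) (l t) =
          RetailPricing.salesInvariant S c (I t) (p t) (ρ t))) ∧
    (∃ C : ℝ, ∀ t ∈ Set.Ioo 0 T,
      RetailPricing.salesInvariant S c (I t) (p t) (ρ t) = C) := by
  open RetailPricing in
  have hadm := hopt.1
  have hSp : ∀ t ∈ Set.Ioo 0 T, DifferentiableAt ℝ (S (I t)) (p t) := fun t ht =>
    DifferentiableAt.comp (f := fun q => (I t, q)) (p t)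
      ((hS t ht).differentiableAt one_ne_zero) (by fun_prop)
  have hSx : ∀ t ∈ Set.Ioo 0 T, DifferentiableAt ℝ (fun x => S x (p t)) (I t) := fun t ht =>
    DifferentiableAt.comp (f := fun x => (x, p t)) (I t)
      ((hS t ht).differentiableAt one_ne_zero) (by fun_prop)
  have hinv : ∀ l : ℝ → Fin n → ℝ, (∀ t ∈ Set.Ioo 0 T, PriceEquation S (I t) (p t) (l t)) →
      ∀ t ∈ Set.Ioo 0 T, hamiltonianQuantity S c (I t) (p t) (ρ t) (l t) =
        salesInvariant S c (I t) (p t) (ρ t) := fun l hl t ht =>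
    (hl t ht).hamiltonianQuantity_eq (hΓ t ht) (hadm.sales_pos t ht)
  have hconst : ∀ l : ℝ → Fin n → ℝ, (∀ t ∈ Set.Ioo 0 T, PriceEquation S (I t) (p t) (l t)) →
      ∃ C : ℝ, ∀ t ∈ Set.Ioo 0 T, hamiltonianQuantity S c (I t) (p t) (ρ t) (l t) = C :=
    fun l hl => by
      have hd := fun t (ht : t ∈ Set.Ioo 0 T) =>
        (hopt.necessary_conditions hσ_cont hσ_pos hS hΓ hl ht).2.2
      exact isOpen_Ioo.exists_is_const_of_deriv_eq_zero isPreconnected_Ioo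
        (fun t ht => (hd t ht).differentiableAt.differentiableWithinAt) fun t ht => (hd t ht).deriv
  have hex : ∀ t, ∃ l, t ∈ Set.Ioo 0 T → PriceEquation S (I t) (p t) l := fun t => by
    by_cases ht : t ∈ Set.Ioo 0 T
    · obtain ⟨l, hl⟩ := exists_priceEquation (hΓ t ht) (hadm.price_pos t ht)
      exact ⟨l, fun _ => hl⟩
    · exact ⟨0, fun h => absurd h ht⟩
  choose l hl using hex
  -- any solution of the price equation is a multiplier
  refine ⟨⟨l, fun t ht => ?_, fun t ht => ?_, fun t ht => ?_⟩, fun m hm => ?_, ?_⟩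
  · exact hasFDerivAt_lagrangian_replenishment
      (hopt.necessary_conditions hσ_cont hσ_pos hS hΓ hl ht).1
  · exact (hasFDerivAt_lagrangian_price_zero_iff (hSp t ht) (hσ_pos t ht).ne').2 (hl t ht)
  · simp only [fderiv_lagrangian_velocity]
    rw [(hasFDerivAt_lagrangian_inventory (hSx t ht)).fderiv]
    have hd := fun i : Fin n => (hopt.necessary_conditions hσ_cont hσ_pos hS hΓ hl ht).2.1
      (Pi.single i 1)
    simp only [dotProduct_single_one] at hd
    refine (HasDerivAt.fun_sum (u := Finset.univ) fun i _ => (hd i).smul_const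
      (ContinuousLinearMap.proj (R := ℝ) (φ := fun _ : Fin n => ℝ) i)).congr_deriv ?_
    conv_rhs => rw [← sum_apply_single_smul_proj (_ • _)]
    simp only [_root_.smul_apply, ContinuousLinearMap.comp_apply, dotCLM_apply, smul_eq_mul]
  · have hm' : ∀ t ∈ Set.Ioo 0 T, PriceEquation S (I t) (p t) (m t) := fun t ht =>
      (hasFDerivAt_lagrangian_price_zero_iff (hSp t ht) (hσ_pos t ht).ne').1 (hm.price_eq t ht)
    exact ⟨hconst m hm', hinv m hm'⟩
  · obtain ⟨C, hC⟩ := hconst l hl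
    exact ⟨C, fun t ht => (hinv l hl t ht).symm.trans (hC t ht)⟩
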